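/- Let $K$ be a local field of positive characteristic $p$ (non-discrete, locally compact, with non-archimedean absolute value $|\cdot|$), $\mathcal O=\{|x|\le 1\}$, $\mathfrak P=\{|x|<1\}$, $\mathfrak p$ a prime element, $\mathcal O/\mathfrak P\cong GF(q)$ with $q=p^c$, and let $dx$ be the Haar measure of $K^+$ with $|\mathcal O|=1$. Fix $1=\epsilon_0,\epsilon_1,\dots,\epsilon_{c-1}\in\mathcal O\setminus\mathfrak P$ whose residue classes form a basis of $\mathcal O/\mathfrak P$ over $GF(p)$. For $0\le n<q$, $n=\sum_{k<c}a_kp^k$ with $0\le a_k<p$, put $u(n)=\big(\sum_k a_k\epsilon_k\big)\mathfrak p^{-1}$, and for $n=\sum_{k=0}^s b_kq^k$ with $0\le b_k<q$ put $u(n)=\sum_k u(b_k)\mathfrak p^{-k}$; let $\mathcal Z=\{u(n):n\in\mathbb N_0\}$. Fix a (continuous, unitary) character $\chi$ of $K^+$ that is trivial on $\mathcal O$, nontrivial on $\mathfrak P^{-1}=\mathfrak p^{-1}\mathcal O$, and normalized so that $\chi(\epsilon_i\epsilon_j\mathfrak p^{-m})=1$ for all $i,j$ and all $m\ge 2$.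 Let $f\mapsto\hat f$ be the bounded extension to $L^2(K)$ of the Fourier transform $\hat f(\xi)=\int_K f(x)\chi(-\xi x)\,dx$ on $L^1(K)\cap L^2(K)$, let $T_kf(x)=f(x-u(k))$, and let $\mathcal T:L^2(K)\to L^2(\mathcal O,\ell^2(\mathcal Z))$, $\mathcal Tf(\xi)=\big(\hat f(\xi+u(k))\big)_{k\in\mathbb N_0}$, be the fiberization map; $\hat f$ and $\mathcal T f$ are well defined on $L^2(K)$. Let $V$ be a $\mathcal Z$-translation invariant space, i.e. a closed subspace of $L^2(K)$ with $T_kV\subset V$ for all $k$. Then $V$ has a range function $J(\xi)=\{\mathcal Tf(\xi):f\in V\}$, understood up to null sets: a map $J$ from $\mathcal O$ to the closed subspaces of $\ell^2(\mathcal Z)$ such that $\mathcal Tf(\xi)\in J(\xi)$ for a.e. $\xi$, for every $f\in V$, and such that, for some countable $A\subset V$, the set $\{\mathcal Tf(\xi):f\in A\}$ is dense in $J(\xi)$ for a.e. $\xi\in\mathcal O$. For every such $J$, $$\mathcal T(V)=\{F\in L^2(\mathcal O,\ell^2(\mathcal Z)):\ F(\xi)\in J(\xi)\ \text{for a.e.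 }\xi\in\mathcal O\}.$$ Moreover, let $m_V(\xi)=\dim J(\xi)\in\{0,1,2,\dots,\infty\}$ be the multiplicity function of $V$. For $\varphi\in L^2(K)$ let $V_\varphi=\overline{\mathrm{span}}\{T_k\varphi:k\in\mathbb N_0\}$. If $V=\bigoplus_n V_{\varphi_n}$ is an orthogonal decomposition, with a finite or countable index set, such that for each $n$ the system $\{T_k\varphi_n\}_{k\in\mathbb N_0}$ is a Parseval frame for $V_{\varphi_n}$, then $$m_V(\xi)=\sum_n\sum_{k\in\mathbb N_0}|\hat\varphi_n(\xi+u(k))|^2\quad\text{for a.e. }\xi\in\mathcal O.$$ -/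

import Mathlib

open MeasureTheory
open scoped ENNReal InnerProductSpace

noncomputable section

namespace LFPC

/-- The standing choices on a local field `K` of characteristic `p`: a prime element `ϖ`, units
`ε 0 = 1, …, ε (c - 1)` whose residue classes form a basis of the residue field `GF(p ^ c)` over
`GF(p)`, and a character `χ` of `K⁺`, trivial on the ring of integers `𝒪 = {‖x‖ ≤ 1}`, nontrivial
on `ϖ⁻¹ 𝒪`, and normalized with respect to `ϖ` and `ε`. -/
structure Data (K : Type*) [NontriviallyNormedField K] (p : ℕ) where
  /-- the prime element -/
  ϖ : K
  norm_ϖ_lt : ‖ϖ‖ < 1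
  norm_le_norm_ϖ : ∀ x : K, ‖x‖ < 1 → ‖x‖ ≤ ‖ϖ‖
  /-- the degree of the residue field over the prime field -/
  c : ℕ
  c_pos : 0 < c
  /-- lifts of a basis of the residue field -/
  ε : Fin c → K
  norm_ε : ∀ i, ‖ε i‖ = 1
  ε_zero : ε ⟨0, c_pos⟩ = 1
  /-- every residue class has unique coordinates in `{0, …, p - 1}` with respect to `ε` -/
  ε_basis : ∀ x : K, ‖x‖ ≤ 1 → ∃! a : Fin c → Fin p, ‖x - ∑ i, ((a i : ℕ) : K) * ε i‖ < 1
  /-- the character of the additive group of `K` -/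
  χ : AddChar K Circle
  continuous_χ : Continuous χ
  χ_integers : ∀ x : K, ‖x‖ ≤ 1 → χ x = 1
  χ_nontrivial : ∃ x : K, ‖x‖ ≤ ‖ϖ‖⁻¹ ∧ χ x ≠ 1
  /-- normalization: only the coefficient of `ϖ⁻¹` matters on products of the `ε i` -/
  χ_normalized : ∀ i j : Fin c, ∀ m : ℕ, 2 ≤ m → χ (ε i * ε j * ϖ⁻¹ ^ m) = 1

variable {K : Type*} [NontriviallyNormedField K] {p : ℕ}

namespace Data

/-- The cardinality `q = p ^ c` of the residue field. -/
def q (D : Data K p) : ℕ := p ^ D.c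

/-- `u(n) = (∑ a_k ε_k) ϖ⁻¹` for `0 ≤ n < q`, where `n = ∑ a_k p ^ k` in base `p`. -/
def uDigit (D : Data K p) (n : ℕ) : K :=
  (∑ k : Fin D.c, ((n / p ^ (k : ℕ) % p : ℕ) : K) * D.ε k) * D.ϖ⁻¹

/-- The translation `u(n) = ∑ u(b_k) ϖ⁻ᵏ`, where `n = ∑ b_k q ^ k` in base `q`
(the digits with `k > n` vanish). -/
def u (D : Data K p) (n : ℕ) : K :=
  ∑ k ∈ Finset.range (n + 1), D.uDigit (n / D.q ^ k % D.q) * D.ϖ⁻¹ ^ k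

end Data

/-- The space `L²(K)`. -/
abbrev L2 [MeasurableSpace K] (μ : Measure K) : Type _ := Lp ℂ 2 μ

/-- The sequence space `ℓ²`, the lattice of translations being indexed by `ℕ`. -/
abbrev Seq : Type := lp (fun _ : ℕ => ℂ) 2

/-- The restriction of the Haar measure to the ring of integers. -/
abbrev onIntegers [MeasurableSpace K] (μ : Measure K) : Measure K :=
  μ.restrict (Metric.closedBall (0 : K) 1)

/-- The space `L²(𝒪, ℓ²)`. -/
abbrev L2Fiber [MeasurableSpace K] (μ : Measure K) : Type _ := Lp Seq 2 (onIntegers μ)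

section Fourier

variable [MeasurableSpace K]

/-- `T` is a bounded operator on `L²(K)` that extends the Fourier transform
`f ↦ ∫ f(x) χ(-ξx) dx` on `L¹(K) ∩ L²(K)`. As this subspace is dense, there is at most one. -/
def IsFourierExtension (D : Data K p) (μ : Measure K) (T : L2 μ →L[ℂ] L2 μ) : Prop :=
  ∀ f : L2 μ, Integrable f μ → T f =ᵐ[μ] Fourier.fourierIntegral D.χ μ f

open Classical in
/-- The Fourier transform on `L²(K)`: the bounded extension of the Fourier integral. -/
def fourier (D : Data K p) (μ : Measure K) : L2 μ →L[ℂ] L2 μ :=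
  if h : ∃ T, IsFourierExtension D μ T then h.choose else 0

/-- `F ∈ L²(𝒪, ℓ²)` is the fiberization of `f`: `F(ξ) = (f̂(ξ + u(k)))_k` for a.e. `ξ ∈ 𝒪`. -/
def IsFiberization (D : Data K p) (μ : Measure K) (f : L2 μ) (F : L2Fiber μ) : Prop :=
  ∀ᵐ ξ ∂(onIntegers μ), ∀ k : ℕ, F ξ k = fourier D μ f (ξ + D.u k)

theorem IsFiberization.unique {D : Data K p} {μ : Measure K} {f : L2 μ} {F G : L2Fiber μ}
    (hF : IsFiberization D μ f F) (hG : IsFiberization D μ f G) : F = G := by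
  refine Lp.ext ?_
  filter_upwards [hF, hG] with ξ h1 h2
  ext k
  rw [h1 k, h2 k]

open Classical in
/-- The fiberization map `𝒯 : L²(K) → L²(𝒪, ℓ²)`. -/
def fiberization (D : Data K p) (μ : Measure K) (f : L2 μ) : L2Fiber μ :=
  if h : ∃ F, IsFiberization D μ f F then h.choose else 0

/-- `J` is the range function of `V`, i.e. `J(ξ) = {𝒯f(ξ) : f ∈ V}`, read up to null sets because
each `𝒯f` is only defined almost everywhere: `J(ξ)` is a closed subspace of `ℓ²` that contains
`𝒯f(ξ)` a.e. for every `f ∈ V`, and in which the values at `ξ` of countably many such `𝒯f` are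
a.e. dense. -/
structure IsRangeFunction (D : Data K p) (μ : Measure K) (V : Submodule ℂ (L2 μ))
    (J : K → ClosedSubmodule ℂ Seq) : Prop where
  mem : ∀ f ∈ V, ∀ᵐ ξ ∂(onIntegers μ), fiberization D μ f ξ ∈ J ξ
  dense : ∃ A : Set (L2 μ), A.Countable ∧ A ⊆ V ∧ ∀ᵐ ξ ∂(onIntegers μ),
    (J ξ : Set Seq) ⊆ closure ((fun f => fiberization D μ f ξ) '' A)

/-- The range function is unique up to null sets. -/
theorem IsRangeFunction.ae_eq {D : Data K p} {μ : Measure K} {V : Submodule ℂ (L2 μ)}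
    {J J' : K → ClosedSubmodule ℂ Seq} (h : IsRangeFunction D μ V J)
    (h' : IsRangeFunction D μ V J') : ∀ᵐ ξ ∂(onIntegers μ), J ξ = J' ξ := by
  have key : ∀ {J J' : K → ClosedSubmodule ℂ Seq}, IsRangeFunction D μ V J →
      IsRangeFunction D μ V J' → ∀ᵐ ξ ∂(onIntegers μ), J ξ ≤ J' ξ := by
    intro J J' h h'
    obtain ⟨A, hA, hAV, hd⟩ := h.dense
    have h1 : ∀ᵐ ξ ∂(onIntegers μ), ∀ f ∈ A, fiberization D μ f ξ ∈ J' ξ :=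
      (ae_ball_iff hA).2 fun f hf => h'.mem f (hAV hf)
    filter_upwards [hd, h1] with ξ h2 h3 x hx
    have h4 : closure ((fun f => fiberization D μ f ξ) '' A) ⊆ (J' ξ : Set Seq) :=
      closure_minimal (by rintro _ ⟨f, hf, rfl⟩; exact h3 f hf) (J' ξ).isClosed'
    exact h4 (h2 hx)
  filter_upwards [key h h', key h' h] with ξ h1 h2 using le_antisymm h1 h2

end Fourier

/-- The multiplicity function `dim J(ξ)`, with values in `{0, 1, 2, …, ∞}`. -/
def multiplicity (J : K → ClosedSubmodule ℂ Seq) (ξ : K) : ℕ∞ :=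
  Cardinal.toENat (Module.rank ℂ (J ξ).toSubmodule)

section Translation

variable [MeasurableSpace K] [BorelSpace K] (μ : Measure K) [μ.IsAddHaarMeasure]

/-- The translation operator `T_k f(x) = f(x - u(k))` on `L²(K)`. -/
def translate (D : Data K p) (k : ℕ) : L2 μ →ₗᵢ[ℂ] L2 μ :=
  Lp.compMeasurePreservingₗᵢ ℂ (fun x => x - D.u k) (measurePreserving_sub_right μ (D.u k))

/-- `V` is a closed subspace of `L²(K)` that is invariant under the translations `T_k`. -/
structure IsTranslationInvariant (D : Data K p) (V : Submodule ℂ (L2 μ)) : Prop where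
  isClosed : IsClosed (V : Set (L2 μ))
  translate_mem : ∀ f ∈ V, ∀ k : ℕ, translate μ D k f ∈ V

/-- The principal translation invariant space generated by `φ`. -/
def principal (D : Data K p) (φ : L2 μ) : Submodule ℂ (L2 μ) :=
  (Submodule.span ℂ (Set.range fun k : ℕ => translate μ D k φ)).topologicalClosure

/-- The translates of `φ` form a Parseval frame for the principal space generated by `φ`. -/
def IsParsevalGenerator (D : Data K p) (φ : L2 μ) : Prop :=
  ∀ f ∈ principal μ D φ, HasSum (fun k : ℕ => ‖⟪f, translate μ D k φ⟫_ℂ‖ ^ 2) (‖f‖ ^ 2)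

/-- `V` is the orthogonal direct sum of the principal spaces generated by the `φ n`, each of which
is a Parseval frame generator. -/
structure IsParsevalDecomposition (D : Data K p) (V : Submodule ℂ (L2 μ)) {ι : Type*}
    (φ : ι → L2 μ) : Prop where
  orthogonal : Pairwise fun m n => principal μ D (φ m) ⟂ principal μ D (φ n)
  sum_eq : (⨆ n, principal μ D (φ n)).topologicalClosure = V
  parseval : ∀ n, IsParsevalGenerator μ D (φ n)

end Translation

end LFPC

end

open MeasureTheory
open scoped ENNReal InnerProductSpace

noncomputable section

set_option linter.unusedSectionVars false

namespace LFPC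

section


variable {K : Type*} [NontriviallyNormedField K] {p : ℕ}

namespace Data

/-! ### Digit expansions and the cosets of the ring of integers -/

section Digits

/-! The points `u n` meet every coset of 𝒪 exactly once (`exists_norm_sub_u_le`, `u_inj`), and the
normalization of χ gives χ(u(k)u(l)) = 1 (`χ_mul_u`). Hence the lattice is its own dual: the
characters χ(u(l)·), cut off to the cosets u(k) + 𝒪, form a Hilbert basis of L²(K). The Fourier
integral sends the basis vector with position k and frequency l to the one with position l and
frequency k for the conjugate character, so the Fourier transform is an isometry
(`unitary_isFourierExtension`, `fourier_eq`).

Cutting K into cosets makes 𝒯 an isometry, and self-duality makes it turn T_k into multiplication by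
χ(-u(k)ξ) (`fiberization_translate`). If G is orthogonal to all modulations of F, every Fourier
coefficient of ξ ↦ ⟪F(ξ), G(ξ)⟫ on 𝒪 vanishes, so F(ξ) ⟂ G(ξ) a.e. (`ae_inner_eq_zero`). Therefore a
J-valued G orthogonal to 𝒯(V) is orthogonal to J(ξ) at almost every ξ and vanishes; this identifies
𝒯(V) (`fiberSubmodule_le`).

For the multiplicity formula, the Parseval identity forces ‖𝒯φ_n(ξ)‖² ∈ {0, 1}
(`enorm_sq_fiberization`), and orthogonality of the spaces V_{φ_n} becomes orthogonality of the
fibers. The nonzero fibers are thus an orthonormal system with closed span J(ξ), and the sum of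
squared norms counts it (`toENat_rank_closure_span`). -/

theorem norm_ϖ_pos (D : Data K p) : 0 < ‖D.ϖ‖ := by
  obtain ⟨x, hx0, hx1⟩ := NormedField.exists_norm_lt_one K
  exact hx0.trans_le (D.norm_le_norm_ϖ x hx1)

theorem ϖ_ne_zero (D : Data K p) : D.ϖ ≠ 0 := norm_pos_iff.1 D.norm_ϖ_pos

theorem norm_ϖ_inv_le (D : Data K p) {x : K} (hx : 1 < ‖x‖) : ‖D.ϖ‖⁻¹ ≤ ‖x‖ := by
  have h := D.norm_le_norm_ϖ x⁻¹ (by rw [norm_inv]; exact inv_lt_one_of_one_lt₀ hx)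
  rw [norm_inv] at h
  exact inv_le_of_inv_le₀ (by linarith) h

/-- The residue combination `∑ a_k ε_k` attached to `b = ∑ a_k p ^ k`. -/
def residue (D : Data K p) (b : ℕ) : K :=
  ∑ k : Fin D.c, ((b / p ^ (k : ℕ) % p : ℕ) : K) * D.ε k

theorem uDigit_eq (D : Data K p) (b : ℕ) : D.uDigit b = D.residue b * D.ϖ⁻¹ := rfl

theorem uDigit_zero (D : Data K p) : D.uDigit 0 = 0 := by
  simp [uDigit]

theorem residue_fin (D : Data K p) (b : Fin (p ^ D.c)) :
    D.residue b = ∑ i, (((finFunctionFinEquiv.symm b i : Fin p) : ℕ) : K) * D.ε i := by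
  simp [residue]

theorem exists_residue (D : Data K p) {x : K} (hx : ‖x‖ ≤ 1) :
    ∃ b < D.q, ‖x - D.residue b‖ < 1 := by
  obtain ⟨a, ha, -⟩ := D.ε_basis x hx
  refine ⟨finFunctionFinEquiv a, (finFunctionFinEquiv a).2, ?_⟩
  rw [residue_fin]
  simpa using ha

theorem one_lt_q [Fact p.Prime] (D : Data K p) : 1 < D.q :=
  Nat.one_lt_pow D.c_pos.ne' (Fact.out : p.Prime).one_lt

/-- Digits beyond the length of n are zero and contribute nothing, so the cutoff is free. This is
what allows induction on the number of digits. -/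
theorem u_eq_sum [Fact p.Prime] (D : Data K p) {n M : ℕ} (h : n < D.q ^ M) :
    D.u n = ∑ k ∈ Finset.range M, D.uDigit (n / D.q ^ k % D.q) * D.ϖ⁻¹ ^ k := by
  have key : ∀ A B : ℕ, A ≤ B → n < D.q ^ A →
      ∑ k ∈ Finset.range A, D.uDigit (n / D.q ^ k % D.q) * D.ϖ⁻¹ ^ k =
      ∑ k ∈ Finset.range B, D.uDigit (n / D.q ^ k % D.q) * D.ϖ⁻¹ ^ k := by
    intro A B hAB hA
    refine Finset.sum_subset (Finset.range_mono hAB) fun k _ hk => ?_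
    have hk' : A ≤ k := by simpa using hk
    rw [Nat.div_eq_of_lt (hA.trans_le (Nat.pow_le_pow_right D.one_lt_q.le hk')), Nat.zero_mod,
      uDigit_zero, zero_mul]
  have h1 : n < D.q ^ (n + 1) := (Nat.lt_succ_self n).trans (Nat.lt_pow_self D.one_lt_q)
  rw [u]
  rcases le_total (n + 1) M with hM | hM
  · exact key _ _ hM h1
  · exact (key _ _ hM h).symm

theorem u_zero (D : Data K p) : D.u 0 = 0 := by
  simp [u, uDigit_zero]

theorem u_add_mul [Fact p.Prime] (D : Data K p) {m b N : ℕ} (hm : m < D.q ^ N) (hb : b < D.q) :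
    D.u (m + D.q ^ N * b) = D.u m + D.uDigit b * D.ϖ⁻¹ ^ N := by
  have hq : 0 < D.q := zero_lt_one.trans D.one_lt_q
  have h1 : m + D.q ^ N * b < D.q ^ (N + 1) := by
    rw [pow_succ]
    calc m + D.q ^ N * b < D.q ^ N + D.q ^ N * b := by omega
      _ = D.q ^ N * (b + 1) := by ring
      _ ≤ _ := Nat.mul_le_mul_left _ hb
  rw [D.u_eq_sum h1, D.u_eq_sum hm, Finset.sum_range_succ]
  congr 1
  · refine Finset.sum_congr rfl fun k hk => ?_
    have hk : k < N := by simpa using hk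
    congr 2
    obtain ⟨j, rfl⟩ : ∃ j, N = k + 1 + j := ⟨N - (k + 1), by omega⟩
    have : m + D.q ^ (k + 1 + j) * b = m + D.q ^ k * (D.q * (D.q ^ j * b)) := by ring
    rw [this, Nat.add_mul_div_left _ _ (pow_pos hq k), Nat.add_mul_mod_self_left]
  · rw [Nat.add_mul_div_left _ _ (pow_pos hq N), Nat.div_eq_of_lt hm, zero_add, Nat.mod_eq_of_lt hb]

/-- Every coset of `𝒪` in `K` contains some `u n`. -/
theorem exists_norm_sub_u_le [Fact p.Prime] (D : Data K p) (x : K) : ∃ n, ‖x - D.u n‖ ≤ 1 := by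
  have h0 := D.norm_ϖ_pos
  have key : ∀ (N : ℕ) (x : K), ‖x‖ ≤ ‖D.ϖ‖⁻¹ ^ N → ∃ n < D.q ^ N, ‖x - D.u n‖ ≤ 1 := by
    intro N
    induction N with
    | zero => exact fun x hx => ⟨0, by simp, by simpa [u_zero] using hx⟩
    | succ N ih =>
      intro x hx
      obtain ⟨b, hb, hxb⟩ := D.exists_residue (x := x * D.ϖ ^ (N + 1)) (by
        rw [norm_mul, norm_pow]
        calc _ ≤ ‖D.ϖ‖⁻¹ ^ (N + 1) * ‖D.ϖ‖ ^ (N + 1) := by gcongr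
          _ = 1 := by rw [← mul_pow, inv_mul_cancel₀ h0.ne', one_pow])
      -- Discreteness of the absolute value improves `< 1` to `≤ ‖ϖ‖`: removing the leading digit
      -- gains a full factor ‖ϖ‖.
      have h1 := D.norm_le_norm_ϖ _ hxb
      have h2 : x - D.uDigit b * D.ϖ⁻¹ ^ N =
          (x * D.ϖ ^ (N + 1) - D.residue b) * D.ϖ⁻¹ ^ (N + 1) := by
        have := D.ϖ_ne_zero
        rw [uDigit_eq, inv_pow, inv_pow]
        field_simp
        ring
      obtain ⟨m, hm, hxm⟩ := ih (x - D.uDigit b * D.ϖ⁻¹ ^ N) (by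
        rw [h2, norm_mul, norm_pow, norm_inv]
        calc _ ≤ ‖D.ϖ‖ * ‖D.ϖ‖⁻¹ ^ (N + 1) := by gcongr
          _ = _ := by rw [pow_succ']; field_simp)
      refine ⟨m + D.q ^ N * b, ?_, ?_⟩
      · rw [pow_succ]
        calc m + D.q ^ N * b < D.q ^ N + D.q ^ N * b := by omega
          _ = D.q ^ N * (b + 1) := by ring
          _ ≤ _ := Nat.mul_le_mul_left _ hb
      · rw [D.u_add_mul hm hb]
        convert hxm using 2
        ring
  obtain ⟨N, hN⟩ := pow_unbounded_of_one_lt ‖x‖ ((one_lt_inv₀ h0).2 D.norm_ϖ_lt)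
  obtain ⟨n, -, hn⟩ := key N x hN.le
  exact ⟨n, hn⟩

end Digits

section Ultrametric

variable [IsUltrametricDist K]

theorem norm_sub_le_of_le {x y : K} {r : ℝ} (hx : ‖x‖ ≤ r) (hy : ‖y‖ ≤ r) : ‖x - y‖ ≤ r := by
  rw [sub_eq_add_neg]
  exact (IsUltrametricDist.norm_add_le_max _ _).trans (max_le hx (by rwa [norm_neg]))

theorem norm_residue_le (D : Data K p) (b : ℕ) : ‖D.residue b‖ ≤ 1 := by
  refine IsUltrametricDist.norm_sum_le_of_forall_le_of_nonneg zero_le_one fun i _ => ?_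
  rw [norm_mul, D.norm_ε, mul_one]
  exact IsUltrametricDist.norm_natCast_le_one K _

/-- The base-p digits of b and b' are both coordinates of the same residue class, and these are
unique. -/
theorem residue_inj (D : Data K p) {b b' : ℕ} (hb : b < D.q) (hb' : b' < D.q)
    (h : ‖D.residue b - D.residue b'‖ < 1) : b = b' := by
  obtain ⟨a, -, ha⟩ := D.ε_basis (D.residue b) (D.norm_residue_le b)
  have h1 := ha (finFunctionFinEquiv.symm ⟨b, hb⟩) (by
    have := D.residue_fin ⟨b, hb⟩
    simp only at this
    simp only [← this, sub_self, norm_zero, zero_lt_one])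
  have h2 := ha (finFunctionFinEquiv.symm ⟨b', hb'⟩) (by
    have := D.residue_fin ⟨b', hb'⟩
    simp only at this
    simpa only [← this] using h)
  have := finFunctionFinEquiv.symm.injective (h1.trans h2.symm)
  exact congrArg Fin.val this

theorem norm_u_le [Fact p.Prime] (D : Data K p) {n N : ℕ} (h : n < D.q ^ N) :
    ‖D.u n‖ ≤ ‖D.ϖ‖⁻¹ ^ N := by
  have h1 : 1 ≤ ‖D.ϖ‖⁻¹ := (one_le_inv₀ D.norm_ϖ_pos).2 D.norm_ϖ_lt.le
  rw [D.u_eq_sum h]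
  refine IsUltrametricDist.norm_sum_le_of_forall_le_of_nonneg (by positivity) fun i hi => ?_
  have hi : i + 1 ≤ N := by simpa using hi
  rw [norm_mul, uDigit_eq, norm_mul, norm_pow, norm_inv, mul_assoc, ← pow_succ']
  calc _ ≤ 1 * ‖D.ϖ‖⁻¹ ^ (i + 1) := by gcongr; exact D.norm_residue_le _
    _ ≤ _ := by rw [one_mul]; exact pow_le_pow_right₀ h1 hi

/-- Every coset of `𝒪` in `K` contains at most one `u n`. -/
theorem u_inj [Fact p.Prime] (D : Data K p) {m n : ℕ} (h : ‖D.u m - D.u n‖ ≤ 1) : m = n := by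
  have h0 := D.norm_ϖ_pos
  have hq : 0 < D.q := zero_lt_one.trans D.one_lt_q
  have hϖ1 : 1 < ‖D.ϖ‖⁻¹ := (one_lt_inv₀ h0).2 D.norm_ϖ_lt
  have key : ∀ N m n : ℕ, m < D.q ^ N → n < D.q ^ N → ‖D.u m - D.u n‖ ≤ 1 → m = n := by
    intro N
    induction N with
    | zero => intro m n hm hn _; simp at hm hn; omega
    | succ N ih =>
      intro m n hm hn hmn
      have hqN : 0 < D.q ^ N := pow_pos hq N
      have em := Nat.mod_add_div m (D.q ^ N)
      have en := Nat.mod_add_div n (D.q ^ N)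
      have hbm : m / D.q ^ N < D.q := Nat.div_lt_of_lt_mul (by rwa [← pow_succ])
      have hbn : n / D.q ^ N < D.q := Nat.div_lt_of_lt_mul (by rwa [← pow_succ])
      have hm' := Nat.mod_lt m hqN
      have hn' := Nat.mod_lt n hqN
      have um := D.u_add_mul hm' hbm
      have un := D.u_add_mul hn' hbn
      rw [em] at um
      rw [en] at un
      have hd : m / D.q ^ N = n / D.q ^ N := by
        refine D.residue_inj hbm hbn ?_
        -- Distinct leading digits would make the left side of norm at least ‖ϖ‖⁻¹ ^ (N + 1), while
        -- the right side is bounded by ‖ϖ‖⁻¹ ^ N.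
        have e : (D.residue (m / D.q ^ N) - D.residue (n / D.q ^ N)) * D.ϖ⁻¹ ^ (N + 1) =
            (D.u m - D.u n) - (D.u (m % D.q ^ N) - D.u (n % D.q ^ N)) := by
          rw [um, un, uDigit_eq, uDigit_eq]
          ring
        have hle : ‖(D.u m - D.u n) - (D.u (m % D.q ^ N) - D.u (n % D.q ^ N))‖ ≤
            ‖D.ϖ‖⁻¹ ^ N :=
          norm_sub_le_of_le (hmn.trans (one_le_pow₀ hϖ1.le))
            (norm_sub_le_of_le (D.norm_u_le hm') (D.norm_u_le hn'))
        rw [← e, norm_mul, norm_pow, norm_inv] at hle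
        have hlt : ‖D.ϖ‖⁻¹ ^ N < ‖D.ϖ‖⁻¹ ^ (N + 1) := pow_lt_pow_right₀ hϖ1 N.lt_succ_self
        by_contra hge
        push Not at hge
        have : 1 * ‖D.ϖ‖⁻¹ ^ (N + 1) ≤ ‖D.ϖ‖⁻¹ ^ N := le_trans (by gcongr) hle
        linarith
      have hr : m % D.q ^ N = n % D.q ^ N := by
        refine ih _ _ hm' hn' ?_
        rw [um, un, hd, add_sub_add_right_eq_sub] at hmn
        exact hmn
      rw [← em, ← en, hd, hr]
  have hb : ∀ k, k < D.q ^ k := fun k => Nat.lt_pow_self D.one_lt_q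
  exact key (max m n) m n
    ((hb m).trans_le (Nat.pow_le_pow_right hq (le_max_left _ _)))
    ((hb n).trans_le (Nat.pow_le_pow_right hq (le_max_right _ _))) h

end Ultrametric

/-! ### Self-duality of the lattice and the conjugate character -/

section Character

/-- Each `u` carries at least one factor ϖ⁻¹, so the product is an integer combination of ε_a ε_b
ϖ⁻ᵐ with m ≥ 2, where χ is trivial by normalization. -/
theorem χ_mul_u (D : Data K p) (k l : ℕ) : D.χ (D.u k * D.u l) = 1 := by
  let G : AddSubgroup K :=
    { carrier := {x | D.χ x = 1}
      add_mem' := fun {x y} hx hy => by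
        simp only [Set.mem_ofPred_eq] at *; rw [AddChar.map_add_eq_mul, hx, hy, one_mul]
      zero_mem' := AddChar.map_zero_eq_one _
      neg_mem' := fun {x} hx => by
        simp only [Set.mem_ofPred_eq] at *; rw [AddChar.map_neg_eq_inv, hx, inv_one] }
  change D.u k * D.u l ∈ G
  simp only [u, uDigit, Finset.sum_mul, Finset.mul_sum]
  refine sum_mem fun j _ => sum_mem fun b _ => sum_mem fun i _ => sum_mem fun a _ => ?_
  generalize k / D.q ^ i % D.q / p ^ (a : ℕ) % p = s
  generalize l / D.q ^ j % D.q / p ^ (b : ℕ) % p = t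
  have e : (s : K) * D.ε a * D.ϖ⁻¹ * D.ϖ⁻¹ ^ i * ((t : K) * D.ε b * D.ϖ⁻¹ * D.ϖ⁻¹ ^ j) =
      (s * t) • (D.ε a * D.ε b * D.ϖ⁻¹ ^ (i + j + 2)) := by
    rw [nsmul_eq_mul]; push_cast; ring
  rw [e]
  exact nsmul_mem (D.χ_normalized a b _ (by omega)) _

theorem χ_add_left (D : Data K p) {o x : K} (ho : ‖o‖ ≤ 1) : D.χ (o + x) = D.χ x := by
  rw [AddChar.map_add_eq_mul, D.χ_integers o ho, one_mul]

/-- The conjugate character gives standing choices as well. -/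
def conj (D : Data K p) : Data K p :=
  { D with
    χ := D.χ⁻¹
    continuous_χ := by
      have : (⇑(D.χ⁻¹) : K → Circle) = fun x => D.χ (-x) := by
        ext x; rw [AddChar.inv_apply]
      rw [this]
      exact D.continuous_χ.comp continuous_neg
    χ_integers := fun x hx => by
      rw [AddChar.inv_apply]; exact D.χ_integers _ (by rwa [norm_neg])
    χ_nontrivial := by
      obtain ⟨x, hx, h⟩ := D.χ_nontrivial
      exact ⟨-x, by rwa [norm_neg], by rwa [AddChar.inv_apply, neg_neg]⟩
    χ_normalized := fun i j m hm => by
      rw [AddChar.inv_apply, AddChar.map_neg_eq_inv, D.χ_normalized i j m hm, inv_one] }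

theorem conj_u (D : Data K p) (n : ℕ) : D.conj.u n = D.u n := rfl

theorem conj_χ (D : Data K p) (x : K) : D.conj.χ x = D.χ (-x) := by
  simp only [conj, AddChar.inv_apply]

end Character

end Data

end

end LFPC

/-! ### Integrals of characters over balls and uniqueness of Fourier coefficients -/

namespace LFPC

section


variable {K : Type*} [NontriviallyNormedField K] {p : ℕ}

namespace Data

theorem continuous_coe_χ (D : Data K p) : Continuous fun x => (D.χ x : ℂ) :=
  continuous_subtype_val.comp D.continuous_χ

@[simp] theorem norm_coe_χ (D : Data K p) (x : K) : ‖(D.χ x : ℂ)‖ = 1 := Circle.norm_coe _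

theorem coe_χ_add (D : Data K p) (x y : K) : (D.χ (x + y) : ℂ) = D.χ x * D.χ y := by
  rw [AddChar.map_add_eq_mul, Circle.coe_mul]

theorem conj_coe_χ (D : Data K p) (x : K) : (starRingEnd ℂ) (D.χ x : ℂ) = D.χ (-x) := by
  rw [AddChar.map_neg_eq_inv, Circle.coe_inv_eq_conj]

end Data

variable [MeasurableSpace K] [BorelSpace K] (μ : Measure K) [μ.IsAddHaarMeasure]

theorem setIntegral_closedBall_eq {E : Type*} [NormedAddCommGroup E] [NormedSpace ℝ E]
    (c : K) (r : ℝ) (f : K → E) :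
    ∫ x in Metric.closedBall c r, f x ∂μ = ∫ x in Metric.closedBall 0 r, f (x + c) ∂μ := by
  rw [← integral_indicator measurableSet_closedBall,
    ← integral_indicator measurableSet_closedBall, ← integral_add_right_eq_self _ c]
  refine integral_congr_ae (.of_forall fun x => ?_)
  by_cases hx : x ∈ Metric.closedBall (0 : K) r
  · have : x + c ∈ Metric.closedBall c r := by simpa [dist_eq_norm] using hx
    simp [Set.indicator_of_mem, hx, this]
  · have : x + c ∉ Metric.closedBall c r := by simpa [dist_eq_norm] using hx
    simp [Set.indicator_of_notMem, hx, this]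

variable [ProperSpace K]

namespace Data

variable (D : Data K p)

theorem setIntegral_χ_of_le {r : ℝ} {y : K} (h : ∀ x : K, ‖x‖ ≤ r → ‖y * x‖ ≤ 1) :
    ∫ x in Metric.closedBall 0 r, (D.χ (y * x) : ℂ) ∂μ = μ.real (Metric.closedBall 0 r) := by
  rw [setIntegral_congr_fun (g := fun _ => (1 : ℂ)) measurableSet_closedBall]
  · simp
  · intro x hx
    simp only
    rw [D.χ_integers _ (h x (by simpa using hx)), Circle.coe_one]

variable [IsUltrametricDist K]

/-- With χ(z) ≠ 1 and ‖z‖ ≤ ‖ϖ‖⁻¹ ≤ ‖ya‖, the shift by z/y preserves the ball and multiplies the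
integral by χ(z). -/
theorem setIntegral_χ_of_lt {a y : K} (h : 1 < ‖y * a‖) :
    ∫ x in Metric.closedBall 0 ‖a‖, (D.χ (y * x) : ℂ) ∂μ = 0 := by
  obtain ⟨z, hz, hz1⟩ := D.χ_nontrivial
  have hy : y ≠ 0 := by rintro rfl; simp at h; linarith
  have hx0 : ‖z / y‖ ≤ ‖a‖ := by
    rw [norm_div, div_le_iff₀ (norm_pos_iff.2 hy), mul_comm, ← norm_mul]
    exact hz.trans (D.norm_ϖ_inv_le h)
  have hball : Metric.closedBall (z / y) ‖a‖ = Metric.closedBall 0 ‖a‖ :=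
    (IsUltrametricDist.closedBall_eq_of_mem (by simpa using hx0)).symm
  have e : ∫ x in Metric.closedBall 0 ‖a‖, (D.χ (y * x) : ℂ) ∂μ =
      (∫ x in Metric.closedBall 0 ‖a‖, (D.χ (y * x) : ℂ) ∂μ) * D.χ z := by
    conv_lhs => rw [← hball, setIntegral_closedBall_eq]
    rw [← integral_mul_const]
    congr 1 with x
    rw [mul_add, mul_div_cancel₀ _ hy, coe_χ_add]
  have hz2 : (1 : ℂ) - D.χ z ≠ 0 := by
    rw [sub_ne_zero]
    exact fun h => hz1 (Circle.ext (by rw [← h, Circle.coe_one]))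
  have : (∫ x in Metric.closedBall 0 ‖a‖, (D.χ (y * x) : ℂ) ∂μ) * (1 - D.χ z) = 0 := by
    rw [mul_sub, mul_one, ← e, sub_self]
  exact (mul_eq_zero.1 this).resolve_right hz2

theorem setIntegral_χ_unit (y c : K) :
    ∫ x in Metric.closedBall c 1, (D.χ (y * x) : ℂ) ∂μ =
      if ‖y‖ ≤ 1 then (D.χ (y * c) : ℂ) * μ.real (Metric.closedBall (0 : K) 1) else 0 := by
  rw [setIntegral_closedBall_eq]
  simp_rw [mul_add, coe_χ_add]
  rw [integral_mul_const]
  split_ifs with h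
  · rw [D.setIntegral_χ_of_le μ, mul_comm]
    intro x hx
    rw [norm_mul]
    exact mul_le_one₀ h (norm_nonneg _) hx
  · have := D.setIntegral_χ_of_lt μ (a := 1) (y := y) (by simpa using h)
    rw [norm_one] at this
    rw [this, zero_mul]

end Data

variable [IsUltrametricDist K]

omit [MeasurableSpace K] [BorelSpace K] [ProperSpace K] in
theorem isTopologicalBasis_closedBall : TopologicalSpace.IsTopologicalBasis
    {s : Set K | ∃ b c : K, c ≠ 0 ∧ s = Metric.closedBall b ‖c‖} := by
  refine TopologicalSpace.isTopologicalBasis_of_isOpen_of_nhds ?_ ?_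
  · rintro _ ⟨b, c, hc, rfl⟩
    exact IsUltrametricDist.isOpen_closedBall b (norm_ne_zero_iff.2 hc)
  · intro x s hx hs
    obtain ⟨r, hr, hrs⟩ := Metric.nhds_basis_closedBall.mem_iff.1 (hs.mem_nhds hx)
    obtain ⟨c, hc0, hc⟩ := NormedField.exists_norm_lt K hr
    exact ⟨_, ⟨x, c, norm_pos_iff.1 hc0, rfl⟩, Metric.mem_closedBall_self (norm_nonneg _),
      (Metric.closedBall_subset_closedBall hc.le).trans hrs⟩

omit μ [μ.IsAddHaarMeasure] in
/-- An integrable function whose integrals over all balls and over the whole space vanish is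
zero. -/
theorem ae_eq_zero_of_setIntegral_closedBall {ν : Measure K} {h : K → ℂ} (hh : Integrable h ν)
    (h_univ : ∫ x, h x ∂ν = 0)
    (h_ball : ∀ b c : K, c ≠ 0 → ∫ x in Metric.closedBall b ‖c‖, h x ∂ν = 0) : h =ᵐ[ν] 0 := by
  refine hh.ae_eq_zero_of_forall_setIntegral_eq_zero fun s hs _ => ?_
  -- Two ultrametric balls are nested or disjoint, so the balls form a π-system generating the Borel
  -- sets.
  refine MeasurableSpace.induction_on_inter (C := fun s _ => ∫ x in s, h x ∂ν = 0)
    ((BorelSpace.measurable_eq).trans isTopologicalBasis_closedBall.borel_eq_generateFrom) ?_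
    (by simp) ?_ ?_ ?_ s hs
  · rintro _ ⟨b, c, hc, rfl⟩ _ ⟨b', c', hc', rfl⟩ hne
    rcases IsUltrametricDist.closedBall_subset_trichotomy b b' ‖c‖ ‖c'‖ with h | h | h
    · exact ⟨b, c, hc, Set.inter_eq_left.2 h⟩
    · exact ⟨b', c', hc', Set.inter_eq_right.2 h⟩
    · exact absurd hne (by rw [h.inter_eq]; exact Set.not_nonempty_empty)
  · rintro _ ⟨b, c, hc, rfl⟩
    exact h_ball b c hc
  · intro t ht h0
    rw [setIntegral_compl ht hh, h_univ, h0, sub_zero]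
  · intro f hd hf h0
    rw [integral_iUnion hf hd hh.integrableOn]
    simp [h0]

namespace Data

variable (D : Data K p)

/-- An integrable function on a coset of `𝒪` all of whose Fourier coefficients vanish is zero. -/
theorem ae_eq_zero_of_coeff [Fact p.Prime] (a : K) {h : K → ℂ}
    (hh : IntegrableOn h (Metric.closedBall a 1) μ)
    (h0 : ∀ k, ∫ x in Metric.closedBall a 1, (D.χ (D.u k * x) : ℂ) * h x ∂μ = 0) :
    h =ᵐ[μ.restrict (Metric.closedBall a 1)] 0 := by
  -- Every frequency is within 𝒪 of some u(k), and then χ((y - u(k))x) is constant on the coset a +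
  -- 𝒪.
  have hy : ∀ y : K, ∫ x in Metric.closedBall a 1, (D.χ (y * x) : ℂ) * h x ∂μ = 0 := by
    intro y
    obtain ⟨k, hk⟩ := D.exists_norm_sub_u_le y
    have : ∫ x in Metric.closedBall a 1, (D.χ (y * x) : ℂ) * h x ∂μ =
        ∫ x in Metric.closedBall a 1, (D.χ ((y - D.u k) * a) : ℂ) *
          ((D.χ (D.u k * x) : ℂ) * h x) ∂μ := by
      refine setIntegral_congr_fun measurableSet_closedBall fun x hx => ?_
      have hx : ‖x - a‖ ≤ 1 := by simpa [dist_eq_norm] using hx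
      have e : y * x = (y - D.u k) * (x - a) + ((y - D.u k) * a + D.u k * x) := by ring
      rw [e, D.χ_add_left (by rw [norm_mul]; exact mul_le_one₀ hk (norm_nonneg _) hx),
        coe_χ_add, mul_assoc]
    rw [this, integral_const_mul, h0, mul_zero]
  refine ae_eq_zero_of_setIntegral_closedBall hh (by simpa using hy 0) fun b c hc => ?_
  set ν := μ.restrict (Metric.closedBall a 1) with hν
  set B : Set K := Metric.closedBall (0 : K) ‖c⁻¹‖ with hB
  have hBpos : 0 < μ.real B := by
    refine ENNReal.toReal_pos (Metric.measure_closedBall_pos μ _ ?_).ne'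
      (isCompact_closedBall _ _).measure_lt_top.ne
    exact norm_pos_iff.2 (inv_ne_zero hc)
  -- B is the ball dual to the one of radius ‖c‖: integrating χ(y(x - b)) over y ∈ B yields μ(B)
  -- times the indicator of the ball around b. Fubini then reduces integrals over balls to Fourier
  -- coefficients.
  have inner : ∀ x : K, ∫ y in B, (D.χ (y * (x - b)) : ℂ) * h x ∂μ =
      (Metric.closedBall b ‖c‖).indicator (fun x => (μ.real B : ℂ) * h x) x := by
    intro x
    rw [integral_mul_const]
    simp_rw [mul_comm _ (x - b)]
    by_cases hx : x ∈ Metric.closedBall b ‖c‖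
    · rw [Set.indicator_of_mem hx, D.setIntegral_χ_of_le μ]
      intro y hy
      have hx : ‖x - b‖ ≤ ‖c‖ := by simpa [dist_eq_norm] using hx
      rw [norm_mul]
      calc _ ≤ ‖c‖ * ‖c⁻¹‖ := by gcongr
        _ = 1 := by rw [← norm_mul, mul_inv_cancel₀ hc, norm_one]
    · rw [Set.indicator_of_notMem hx, D.setIntegral_χ_of_lt μ, zero_mul]
      have hx : ‖c‖ < ‖x - b‖ := by simpa [dist_eq_norm] using hx
      rw [norm_mul, norm_inv, ← div_eq_mul_inv, one_lt_div (norm_pos_iff.2 hc)]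
      exact hx
  have swap : ∫ x, ∫ y in B, (D.χ (y * (x - b)) : ℂ) * h x ∂μ ∂ν = 0 := by
    rw [integral_integral_swap]
    · have : ∀ y : K, ∫ x, (D.χ (y * (x - b)) : ℂ) * h x ∂ν = 0 := by
        intro y
        have : ∀ x, (D.χ (y * (x - b)) : ℂ) * h x = D.χ (-(y * b)) * (D.χ (y * x) * h x) := by
          intro x
          rw [← mul_assoc, ← coe_χ_add]
          congr 3
          ring
        simp_rw [this]
        rw [integral_const_mul, hy, mul_zero]
      simp [this]
    · have : IsFiniteMeasure (μ.restrict B) :=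
        ⟨by rw [Measure.restrict_apply_univ]; exact (isCompact_closedBall _ _).measure_lt_top⟩
      have h1 : Integrable (fun z : K × K => h z.1) (ν.prod (μ.restrict B)) := hh.comp_fst _
      refine h1.bdd_mul (c := 1) (f := fun z : K × K => (D.χ (z.2 * (z.1 - b)) : ℂ)) ?_ ?_
      · exact (D.continuous_coe_χ.comp (by fun_prop)).aestronglyMeasurable
      · exact .of_forall fun z => by simp
  simp_rw [inner] at swap
  rw [integral_indicator measurableSet_closedBall, integral_const_mul] at swap
  exact (mul_eq_zero.1 swap).resolve_left (by exact_mod_cast hBpos.ne')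

end Data

end

end LFPC

/-! ### The Hilbert basis of cut-off characters and the Fourier transform on L²(K) -/

namespace LFPC

section


variable {K : Type*} [NontriviallyNormedField K] {p : ℕ} [Fact p.Prime] [IsUltrametricDist K]

namespace Data

variable (D : Data K p)

theorem pairwise_disjoint_coset :
    Pairwise (Function.onFun Disjoint fun k => Metric.closedBall (D.u k) 1) := by
  intro k l hkl
  rw [Function.onFun, Set.disjoint_left]
  intro x hk hl
  refine hkl (D.u_inj ?_)
  have hk : ‖x - D.u k‖ ≤ 1 := by simpa [dist_eq_norm] using hk
  have hl : ‖x - D.u l‖ ≤ 1 := by simpa [dist_eq_norm] using hl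
  have := norm_sub_le_of_le hl hk
  simpa using this

theorem iUnion_coset : ⋃ k, Metric.closedBall (D.u k) 1 = Set.univ := by
  refine Set.eq_univ_of_forall fun x => ?_
  obtain ⟨k, hk⟩ := D.exists_norm_sub_u_le x
  exact Set.mem_iUnion.2 ⟨k, by simpa [dist_eq_norm] using hk⟩

end Data

variable [MeasurableSpace K] [BorelSpace K] (μ : Measure K) [μ.IsAddHaarMeasure] [ProperSpace K]

namespace Data

variable (D : Data K p)

theorem ae_of_forall_coset {P : K → Prop}
    (h : ∀ k, ∀ᵐ x ∂(μ.restrict (Metric.closedBall (D.u k) 1)), P x) : ∀ᵐ x ∂μ, P x := by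
  rw [← Measure.restrict_univ (μ := μ), ← D.iUnion_coset]
  exact (ae_restrict_iUnion_iff _ _).2 h

/-- The character `x ↦ χ(u(l) x)` cut off to the coset `u(k) + 𝒪`. -/
def atomFun (k l : ℕ) : K → ℂ :=
  (Metric.closedBall (D.u k) 1).indicator fun x => (D.χ (D.u l * x) : ℂ)

theorem memLp_atomFun (k l : ℕ) (r : ℝ≥0∞) : MemLp (D.atomFun k l) r μ := by
  have hm : AEStronglyMeasurable (fun x => (D.χ (D.u l * x) : ℂ))
      (μ.restrict (Metric.closedBall (D.u k) 1)) :=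
    (D.continuous_coe_χ.comp (by fun_prop)).aestronglyMeasurable
  rw [atomFun, memLp_indicator_iff_restrict measurableSet_closedBall]
  have : IsFiniteMeasure (μ.restrict (Metric.closedBall (D.u k) 1)) :=
    ⟨by rw [Measure.restrict_apply_univ]; exact (isCompact_closedBall _ _).measure_lt_top⟩
  exact MemLp.of_bound hm 1 (.of_forall fun x => by simp)

/-- The function `atomFun` as an element of `L²(K)`. -/
def atom (k l : ℕ) : L2 μ := (D.memLp_atomFun μ k l 2).toLp _

theorem coeFn_atom (k l : ℕ) : D.atom μ k l =ᵐ[μ] D.atomFun k l := MemLp.coeFn_toLp _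

theorem inner_atom (k l : ℕ) (g : L2 μ) : ⟪D.atom μ k l, g⟫_ℂ =
    ∫ x in Metric.closedBall (D.u k) 1, (D.χ (-(D.u l * x)) : ℂ) * g x ∂μ := by
  rw [L2.inner_def, ← integral_indicator measurableSet_closedBall]
  refine integral_congr_ae ?_
  filter_upwards [D.coeFn_atom μ k l] with x hx
  rw [hx, RCLike.inner_apply, atomFun]
  by_cases h : x ∈ Metric.closedBall (D.u k) 1
  · rw [Set.indicator_of_mem h, Set.indicator_of_mem h, conj_coe_χ, mul_comm]
  · rw [Set.indicator_of_notMem h, Set.indicator_of_notMem h, map_zero, mul_zero]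

theorem integrableOn_coset (g : L2 μ) (c : K) : IntegrableOn g (Metric.closedBall c 1) μ := by
  have : IsFiniteMeasure (μ.restrict (Metric.closedBall c 1)) :=
    ⟨by rw [Measure.restrict_apply_univ]; exact (isCompact_closedBall _ _).measure_lt_top⟩
  exact ((Lp.memLp g).restrict _).integrable (by norm_num)

variable {μ}

theorem orthonormal_atom (hμ : μ (Metric.closedBall (0 : K) 1) = 1) :
    Orthonormal ℂ fun i : ℕ × ℕ => D.atom μ i.1 i.2 := by
  rw [orthonormal_iff_ite]
  rintro ⟨k, l⟩ ⟨k', l'⟩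
  rw [inner_atom]
  have e : ∫ x in Metric.closedBall (D.u k) 1, (D.χ (-(D.u l * x)) : ℂ) * D.atom μ k' l' x ∂μ =
      ∫ x in Metric.closedBall (D.u k) 1, (D.χ (-(D.u l * x)) : ℂ) * D.atomFun k' l' x ∂μ := by
    refine integral_congr_ae ?_
    filter_upwards [ae_restrict_of_ae (D.coeFn_atom μ k' l')] with x hx
    rw [hx]
  rw [e]
  by_cases hk : k = k'
  · subst hk
    have e : ∫ x in Metric.closedBall (D.u k) 1, (D.χ (-(D.u l * x)) : ℂ) * D.atomFun k l' x ∂μ =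
        ∫ x in Metric.closedBall (D.u k) 1, (D.χ ((D.u l' - D.u l) * x) : ℂ) ∂μ := by
      refine setIntegral_congr_fun measurableSet_closedBall fun x hx => ?_
      rw [atomFun, Set.indicator_of_mem hx, ← coe_χ_add]
      congr 2
      ring
    rw [e, setIntegral_χ_unit]
    by_cases hl : l = l'
    · subst hl
      simp [measureReal_def, hμ]
    · rw [if_neg (fun h => hl (D.u_inj h).symm), if_neg (by simp [hl])]
  · rw [if_neg (by simp [hk])]
    rw [setIntegral_congr_fun (g := fun _ => (0 : ℂ)) measurableSet_closedBall, integral_zero]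
    intro x hx
    have : x ∉ Metric.closedBall (D.u k') 1 :=
      fun h => (Set.disjoint_left.1 (D.pairwise_disjoint_coset hk)) hx h
    simp only
    rw [atomFun, Set.indicator_of_notMem this, mul_zero]

/-- The inner product conjugates the atom, so these are the Fourier coefficients of g on each coset
for the conjugate character; this is why `conj` appears. -/
theorem eq_zero_of_inner_atom {g : L2 μ} (h : ∀ k l, ⟪D.atom μ k l, g⟫_ℂ = 0) : g = 0 := by
  refine Lp.eq_zero_iff_ae_eq_zero.2 ?_
  refine D.ae_of_forall_coset μ fun k => ?_
  refine D.conj.ae_eq_zero_of_coeff μ _ (integrableOn_coset μ g _) fun l => ?_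
  rw [← h k l, inner_atom]
  simp only [conj_χ, conj_u]

/-- The cut off characters form a Hilbert basis of `L²(K)`. -/
def atomBasis (hμ : μ (Metric.closedBall (0 : K) 1) = 1) : HilbertBasis (ℕ × ℕ) ℂ (L2 μ) :=
  HilbertBasis.mkOfOrthogonalEqBot (D.orthonormal_atom hμ) (by
    rw [Submodule.eq_bot_iff]
    intro g hg
    refine D.eq_zero_of_inner_atom fun k l => ?_
    exact (Submodule.mem_orthogonal _ _).1 hg _ (Submodule.subset_span ⟨(k, l), rfl⟩))

theorem atomBasis_apply (hμ : μ (Metric.closedBall (0 : K) 1) = 1) (i : ℕ × ℕ) :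
    D.atomBasis hμ i = D.atom μ i.1 i.2 := by
  rw [atomBasis, HilbertBasis.coe_mkOfOrthogonalEqBot]

/-- The basis `atomBasis` with the roles of position and frequency exchanged. -/
def atomBasisSwap (hμ : μ (Metric.closedBall (0 : K) 1) = 1) : HilbertBasis (ℕ × ℕ) ℂ (L2 μ) :=
  HilbertBasis.mkOfOrthogonalEqBot ((D.orthonormal_atom hμ).comp Prod.swap Prod.swap_injective) (by
    rw [Submodule.eq_bot_iff]
    intro g hg
    refine D.eq_zero_of_inner_atom fun k l => ?_
    exact (Submodule.mem_orthogonal _ _).1 hg _ (Submodule.subset_span ⟨(l, k), rfl⟩))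

theorem atomBasisSwap_apply (hμ : μ (Metric.closedBall (0 : K) 1) = 1) (i : ℕ × ℕ) :
    D.atomBasisSwap hμ i = D.atom μ i.2 i.1 := by
  rw [atomBasisSwap, HilbertBasis.coe_mkOfOrthogonalEqBot]
  rfl

/-- The unitary operator that maps the cut off characters of `χ` to those of the conjugate
character, exchanging position and frequency. -/
def unitary (hμ : μ (Metric.closedBall (0 : K) 1) = 1) : L2 μ →ₗᵢ[ℂ] L2 μ :=
  ((D.atomBasis hμ).repr.trans (D.conj.atomBasisSwap hμ).repr.symm).toLinearIsometry

theorem inner_unitary (hμ : μ (Metric.closedBall (0 : K) 1) = 1) (k l : ℕ) (f : L2 μ) :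
    ⟪D.conj.atom μ l k, D.unitary hμ f⟫_ℂ = ⟪D.atom μ k l, f⟫_ℂ := by
  have h1 := D.atomBasis_apply hμ (k, l)
  have h2 := D.conj.atomBasisSwap_apply hμ (k, l)
  rw [← h1, ← h2, ← HilbertBasis.repr_apply_apply, ← HilbertBasis.repr_apply_apply, unitary]
  simp

/-- On each coset both sides are integrable, so comparing Fourier coefficients suffices. Those of
the Fourier integral are computed by Fubini. -/
theorem unitary_isFourierExtension (hμ : μ (Metric.closedBall (0 : K) 1) = 1) :
    IsFourierExtension D μ (D.unitary hμ).toContinuousLinearMap := by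
  intro f hf
  have hint : ∀ (s : Set K), IsCompact s → Integrable (fun z : K × K =>
      (D.χ (-(z.1 * z.2)) : ℂ) * f z.1) (μ.prod (μ.restrict s)) := by
    intro s hs
    have : IsFiniteMeasure (μ.restrict s) :=
      ⟨by rw [Measure.restrict_apply_univ]; exact hs.measure_lt_top⟩
    refine (hf.comp_fst (μ.restrict s)).bdd_mul (c := 1)
      (f := fun z : K × K => (D.χ (-(z.1 * z.2)) : ℂ)) ?_ ?_
    · exact (D.continuous_coe_χ.comp (by fun_prop)).aestronglyMeasurable
    · exact .of_forall fun z => by simp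
  have hF : ∀ w, Fourier.fourierIntegral D.χ μ f w = ∫ v, (D.χ (-(v * w)) : ℂ) * f v ∂μ := by
    intro w
    rw [Fourier.fourierIntegral_def]
    rfl
  have hFint : ∀ l, IntegrableOn (Fourier.fourierIntegral D.χ μ f)
      (Metric.closedBall (D.u l) 1) μ := by
    intro l
    have := (hint _ (isCompact_closedBall (D.u l) 1)).integral_prod_right
    exact this.congr (.of_forall fun w => (hF w).symm)
  suffices h : ∀ᵐ w ∂μ, D.unitary hμ f w - Fourier.fourierIntegral D.χ μ f w = 0 by
    filter_upwards [h] with w hw using sub_eq_zero.1 hw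
  refine D.ae_of_forall_coset μ fun l => ?_
  refine D.ae_eq_zero_of_coeff μ _ ((integrableOn_coset μ _ _).sub (hFint l)) fun k => ?_
  have hb : ∀ {g : K → ℂ}, IntegrableOn g (Metric.closedBall (D.u l) 1) μ →
      IntegrableOn (fun w => (D.χ (D.u k * w) : ℂ) * g w) (Metric.closedBall (D.u l) 1) μ := by
    intro g hg
    exact Integrable.bdd_mul (c := 1) hg
      (D.continuous_coe_χ.comp (by fun_prop)).aestronglyMeasurable (.of_forall fun z => by simp)
  simp_rw [mul_sub]
  rw [integral_sub (hb (integrableOn_coset μ _ _)) (hb (hFint l)), sub_eq_zero]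
  have e1 := D.inner_unitary hμ k l f
  rw [inner_atom, inner_atom] at e1
  simp only [conj_χ, conj_u, neg_neg] at e1
  rw [e1]
  -- The integral over w vanishes unless v ∈ u(k) + 𝒪; there it produces χ((u(k) - v)u(l)), which is
  -- χ(-u(l)v) by self-duality.
  have e2 : ∀ v : K, ∫ w in Metric.closedBall (D.u l) 1,
      (D.χ (D.u k * w) : ℂ) * ((D.χ (-(v * w)) : ℂ) * f v) ∂μ =
      (Metric.closedBall (D.u k) 1).indicator (fun v => (D.χ (-(D.u l * v)) : ℂ) * f v) v := by
    intro v
    have : ∀ w, (D.χ (D.u k * w) : ℂ) * ((D.χ (-(v * w)) : ℂ) * f v) =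
        (D.χ ((D.u k - v) * w) : ℂ) * f v := by
      intro w
      rw [← mul_assoc, ← coe_χ_add]
      congr 3
      ring
    simp_rw [this]
    rw [integral_mul_const, setIntegral_χ_unit]
    have hn : ‖D.u k - v‖ ≤ 1 ↔ v ∈ Metric.closedBall (D.u k) 1 := by
      rw [Metric.mem_closedBall, dist_comm, dist_eq_norm]
    by_cases h : ‖D.u k - v‖ ≤ 1
    · rw [if_pos h, Set.indicator_of_mem (hn.1 h)]
      have : (D.u k - v) * D.u l = D.u k * D.u l + -(D.u l * v) := by ring
      rw [this, coe_χ_add, χ_mul_u]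
      simp [measureReal_def, hμ]
    · rw [if_neg h, Set.indicator_of_notMem (fun h' => h (hn.2 h')), zero_mul]
  simp_rw [hF, ← integral_const_mul]
  rw [← integral_integral_swap]
  · simp_rw [e2]
    rw [integral_indicator measurableSet_closedBall]
  · refine (hint _ (isCompact_closedBall (D.u l) 1)).bdd_mul (c := 1)
      (f := fun z : K × K => (D.χ (D.u k * z.2) : ℂ)) ?_ ?_
    · exact (D.continuous_coe_χ.comp (by fun_prop)).aestronglyMeasurable
    · exact .of_forall fun z => by simp

theorem dense_span_atom (hμ : μ (Metric.closedBall (0 : K) 1) = 1) :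
    Dense (Submodule.span ℂ (Set.range fun i : ℕ × ℕ => D.atom μ i.1 i.2) : Set (L2 μ)) := by
  rw [Submodule.dense_iff_topologicalClosure_eq_top]
  have := (D.atomBasis hμ).dense_span
  rwa [funext (D.atomBasis_apply hμ)] at this

/-- Two bounded operators on `L²(K)` agree if they agree on integrable functions. -/
theorem clm_ext (D : Data K p) (hμ : μ (Metric.closedBall (0 : K) 1) = 1) {S T : L2 μ →L[ℂ] L2 μ}
    (h : ∀ f : L2 μ, Integrable f μ → S f = T f) : S = T := by
  refine ContinuousLinearMap.ext_on (D.dense_span_atom hμ) ?_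
  rintro _ ⟨i, rfl⟩
  refine h _ ?_
  exact (integrable_congr (D.coeFn_atom μ i.1 i.2)).2
    (memLp_one_iff_integrable.1 (D.memLp_atomFun μ i.1 i.2 1))

theorem fourier_spec (hμ : μ (Metric.closedBall (0 : K) 1) = 1) :
    IsFourierExtension D μ (fourier D μ) := by
  have h : ∃ T, IsFourierExtension D μ T := ⟨_, D.unitary_isFourierExtension hμ⟩
  rw [fourier, dif_pos h]
  exact h.choose_spec

/-- Uniqueness of the extension identifies the chosen operator with the explicit one, and so shows
that it is isometric. -/
theorem fourier_eq (hμ : μ (Metric.closedBall (0 : K) 1) = 1) :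
    fourier D μ = (D.unitary hμ).toContinuousLinearMap :=
  D.clm_ext hμ fun f hf => Lp.ext
    ((D.fourier_spec hμ f hf).trans (D.unitary_isFourierExtension hμ f hf).symm)

end Data

theorem memLp_circle_mul (c : C(K, Circle)) (f : L2 μ) :
    MemLp (fun x => (c x : ℂ) * f x) 2 μ := by
  refine (Lp.memLp f).congr_norm (((continuous_subtype_val.comp
    c.continuous).aestronglyMeasurable).mul (Lp.aestronglyMeasurable f)) (.of_forall fun x => ?_)
  rw [norm_mul, Circle.norm_coe, one_mul]

/-- Multiplication by a continuous unimodular function, as an isometry of `L²(K)`. -/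
def mulCircle (c : C(K, Circle)) : L2 μ →ₗᵢ[ℂ] L2 μ where
  toFun f := (memLp_circle_mul μ c f).toLp _
  map_add' f g := by
    refine Lp.ext ?_
    filter_upwards [Lp.coeFn_add f g, (memLp_circle_mul μ c (f + g)).coeFn_toLp,
      (memLp_circle_mul μ c f).coeFn_toLp, (memLp_circle_mul μ c g).coeFn_toLp,
      Lp.coeFn_add ((memLp_circle_mul μ c f).toLp _) ((memLp_circle_mul μ c g).toLp _)]
      with x h1 h2 h3 h4 h5
    rw [h2, h5, h1, Pi.add_apply, Pi.add_apply, h3, h4, mul_add]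
  map_smul' a f := by
    refine Lp.ext ?_
    filter_upwards [Lp.coeFn_smul a f, (memLp_circle_mul μ c (a • f)).coeFn_toLp,
      (memLp_circle_mul μ c f).coeFn_toLp, Lp.coeFn_smul a ((memLp_circle_mul μ c f).toLp _)]
      with x h1 h2 h3 h4
    rw [h2, RingHom.id_apply, h4, h1, Pi.smul_apply, Pi.smul_apply, h3, mul_smul_comm]
  norm_map' f := by
    refine congrArg ENNReal.toReal ((eLpNorm_congr_ae (memLp_circle_mul μ c f).coeFn_toLp).trans
      (eLpNorm_congr_norm_ae (.of_forall fun x => ?_)))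
    rw [norm_mul, Circle.norm_coe, one_mul]

theorem coeFn_mulCircle (c : C(K, Circle)) (f : L2 μ) :
    mulCircle μ c f =ᵐ[μ] fun x => (c x : ℂ) * f x := (memLp_circle_mul μ c f).coeFn_toLp

namespace Data

variable (D : Data K p) {μ}

theorem coeFn_translate (k : ℕ) (f : L2 μ) :
    translate μ D k f =ᵐ[μ] fun x => f (x - D.u k) :=
  Lp.coeFn_compMeasurePreserving f (measurePreserving_sub_right μ (D.u k))

/-- The Fourier transform turns translations into modulations. -/
theorem fourier_translate (hμ : μ (Metric.closedBall (0 : K) 1) = 1) (k : ℕ) (f : L2 μ) :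
    fourier D μ (translate μ D k f) =ᵐ[μ]
      fun ξ => (D.χ (-(D.u k * ξ)) : ℂ) * fourier D μ f ξ := by
  let c : C(K, Circle) := ⟨fun ξ => D.χ (-(D.u k * ξ)), D.continuous_χ.comp (by fun_prop)⟩
  -- Both sides are bounded, so it is enough to substitute in the Fourier integral of an integrable
  -- f.
  have key : fourier D μ ∘L (translate μ D k).toContinuousLinearMap =
      (mulCircle μ c).toContinuousLinearMap ∘L fourier D μ := by
    refine D.clm_ext hμ fun f hf => Lp.ext ?_
    have hi : Integrable (translate μ D k f) μ :=
      (integrable_congr (D.coeFn_translate k f)).2 (hf.comp_sub_right _)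
    refine (D.fourier_spec hμ _ hi).trans ((coeFn_mulCircle μ c _).trans ?_).symm
    filter_upwards [D.fourier_spec hμ f hf] with ξ hξ
    change (c ξ : ℂ) * fourier D μ f ξ = _
    rw [hξ, Fourier.fourierIntegral_def, Fourier.fourierIntegral_def]
    have e : ∫ v, D.χ (-(v * ξ)) • translate μ D k f v ∂μ =
        ∫ v, D.χ (-(v * ξ)) • f (v - D.u k) ∂μ := by
      refine integral_congr_ae ?_
      filter_upwards [D.coeFn_translate k f] with x hx
      rw [hx]
    rw [e, ← integral_add_right_eq_self (fun v => D.χ (-(v * ξ)) • f (v - D.u k)) (D.u k),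
      ← integral_const_mul]
    refine integral_congr_ae (.of_forall fun v => ?_)
    change (D.χ (-(D.u k * ξ)) : ℂ) * ((D.χ (-(v * ξ)) : ℂ) * f v) =
      (D.χ (-((v + D.u k) * ξ)) : ℂ) * f (v + D.u k - D.u k)
    rw [add_sub_cancel_right, ← mul_assoc, ← coe_χ_add]
    congr 3
    ring
  have := congrArg (fun T : L2 μ →L[ℂ] L2 μ => T f) key
  simp only [ContinuousLinearMap.comp_apply, LinearIsometry.coe_toContinuousLinearMap] at this
  rw [this]
  exact coeFn_mulCircle μ c _

end Data

end

end LFPC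

/-! ### Fiberization, range functions and the image of an invariant space -/

namespace LFPC

section


theorem eLpNorm_two_sq {α E : Type*} [MeasurableSpace α] [NormedAddCommGroup E] (ν : Measure α)
    (f : α → E) : eLpNorm f 2 ν ^ 2 = ∫⁻ x, ‖f x‖ₑ ^ 2 ∂ν := by
  have := eLpNorm_nnreal_pow_eq_lintegral (μ := ν) (f := f) (p := 2) (by norm_num)
  simpa using this

theorem enorm_sq_lp {ι : Type*} (x : lp (fun _ : ι => ℂ) 2) :
    ‖x‖ₑ ^ 2 = ∑' k, ‖x k‖ₑ ^ 2 := by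
  have h := lp.hasSum_norm (p := 2) (by norm_num) x
  simp only [ENNReal.toReal_ofNat, Real.rpow_ofNat] at h
  have e : ∀ y : ℂ, ‖y‖ₑ ^ 2 = ENNReal.ofReal (‖y‖ ^ 2) := fun y => by
    rw [← ofReal_norm, ENNReal.ofReal_pow (norm_nonneg _)]
  simp_rw [e]
  rw [← ofReal_norm, ← ENNReal.ofReal_pow (norm_nonneg _), ← h.tsum_eq,
    ENNReal.ofReal_tsum_of_nonneg (fun _ => by positivity) h.summable]

theorem memℓp_two_of_tsum {x : ℕ → ℂ} (h : ∑' k, ‖x k‖ₑ ^ 2 ≠ ∞) : Memℓp x 2 := by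
  rw [memℓp_gen_iff (by norm_num)]
  have := ENNReal.summable_toReal h
  simpa using this

variable {K : Type*} [NontriviallyNormedField K] {p : ℕ} [Fact p.Prime] [IsUltrametricDist K]
variable [MeasurableSpace K] [BorelSpace K] {μ : Measure K} [μ.IsAddHaarMeasure] [ProperSpace K]

theorem measurePreserving_integers (c : K) : MeasurePreserving (fun ξ => ξ + c)
    (onIntegers μ) (μ.restrict (Metric.closedBall c 1)) := by
  have h := (measurePreserving_add_right μ c).restrict_preimage
    (s := Metric.closedBall c 1) measurableSet_closedBall
  have e : (fun ξ => ξ + c) ⁻¹' Metric.closedBall c 1 = Metric.closedBall (0 : K) 1 := by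
    ext x; simp [dist_eq_norm]
  rwa [e] at h

instance : IsFiniteMeasure (onIntegers μ) :=
  ⟨by rw [Measure.restrict_apply_univ]; exact (isCompact_closedBall _ _).measure_lt_top⟩

/-- The closed subspace of `L²(𝒪, ℓ²)` of the functions with values in a range function. -/
def fiberSubmodule (μ : Measure K) (J : K → ClosedSubmodule ℂ Seq) :
    Submodule ℂ (L2Fiber μ) where
  carrier := {F | ∀ᵐ ξ ∂(onIntegers μ), F ξ ∈ J ξ}
  add_mem' {F G} hF hG := by
    filter_upwards [hF, hG, Lp.coeFn_add F G] with ξ h1 h2 h3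
    rw [h3]
    exact add_mem h1 h2
  zero_mem' := by
    filter_upwards [Lp.coeFn_zero Seq 2 (onIntegers μ)] with ξ h
    rw [h]
    exact zero_mem _
  smul_mem' a F hF := by
    filter_upwards [hF, Lp.coeFn_smul a F] with ξ h1 h2
    rw [h2]
    exact SMulMemClass.smul_mem a h1

theorem mem_fiberSubmodule {J : K → ClosedSubmodule ℂ Seq} {F : L2Fiber μ} :
    F ∈ fiberSubmodule μ J ↔ ∀ᵐ ξ ∂(onIntegers μ), F ξ ∈ J ξ := Iff.rfl

/-- An L²-convergent sequence has an a.e. convergent subsequence, and each J(ξ) is closed. -/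
theorem isClosed_fiberSubmodule (J : K → ClosedSubmodule ℂ Seq) :
    IsClosed (fiberSubmodule μ J : Set (L2Fiber μ)) := by
  refine IsSeqClosed.isClosed fun F G hF hFG => ?_
  obtain ⟨ns, -, hns⟩ := (tendstoInMeasure_of_tendsto_Lp hFG).exists_seq_tendsto_ae
  have hF' : ∀ᵐ ξ ∂(onIntegers μ), ∀ n, F n ξ ∈ J ξ := ae_all_iff.2 fun n => hF n
  change ∀ᵐ ξ ∂(onIntegers μ), G ξ ∈ J ξ
  filter_upwards [hns, hF'] with ξ h1 h2
  exact (J ξ).isClosed.mem_of_tendsto h1 (.of_forall fun n => h2 _)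

namespace Data

variable (D : Data K p)

theorem lintegral_eq_tsum (φ : K → ℝ≥0∞) :
    ∫⁻ x, φ x ∂μ = ∑' k, ∫⁻ ξ, φ (ξ + D.u k) ∂(onIntegers μ) := by
  rw [← setLIntegral_univ φ, ← D.iUnion_coset,
    lintegral_iUnion (fun _ => measurableSet_closedBall) D.pairwise_disjoint_coset]
  refine tsum_congr fun k => ?_
  exact ((measurePreserving_integers (D.u k)).lintegral_comp_emb
    (measurableEmbedding_addRight _) φ).symm

theorem exists_fiber (g : L2 μ) : ∃ F : L2Fiber μ,
    (∀ᵐ ξ ∂(onIntegers μ), ∀ k, F ξ k = g (ξ + D.u k)) ∧ ‖F‖ = ‖g‖ := by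
  classical
  have hgk : ∀ k, AEStronglyMeasurable (fun ξ => g (ξ + D.u k)) (onIntegers μ) := fun k =>
    ((Lp.aestronglyMeasurable g).restrict).comp_measurePreserving (measurePreserving_integers _)
  have hint : ∫⁻ ξ, ∑' k, ‖g (ξ + D.u k)‖ₑ ^ 2 ∂(onIntegers μ) = ‖g‖ₑ ^ 2 := by
    rw [lintegral_tsum fun k => (hgk k).enorm.pow_const 2,
      ← D.lintegral_eq_tsum fun x => ‖g x‖ₑ ^ 2, ← eLpNorm_two_sq, Lp.enorm_def]
  have hfin : ∀ᵐ ξ ∂(onIntegers μ), ∑' k, ‖g (ξ + D.u k)‖ₑ ^ 2 < ∞ := by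
    refine ae_lt_top' (AEMeasurable.tsum fun k => (hgk k).enorm.pow_const 2) ?_
    rw [hint]
    exact ENNReal.pow_ne_top enorm_ne_top
  -- The default 0 is used only on a null set, since the sum of squares has finite integral ‖g‖².
  let F : K → Seq := fun ξ => if h : Memℓp (fun k => g (ξ + D.u k)) 2 then ⟨_, h⟩ else 0
  have hF : ∀ᵐ ξ ∂(onIntegers μ), ∀ k, F ξ k = g (ξ + D.u k) := by
    filter_upwards [hfin] with ξ hξ k
    simp only [F]
    rw [dif_pos (memℓp_two_of_tsum hξ.ne)]
  have hm : AEStronglyMeasurable F (onIntegers μ) := by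
    -- Measurability into ℓ² comes from the coordinates: F is the a.e. limit of its finite
    -- truncations.
    refine aestronglyMeasurable_of_tendsto_ae Filter.atTop (f := fun n ξ =>
      ∑ k ∈ Finset.range n, lp.single 2 k (g (ξ + D.u k))) (fun n => ?_) ?_
    · refine Finset.aestronglyMeasurable_fun_sum _ fun k _ => ?_
      exact (lp.isometry_single (E := fun _ : ℕ => ℂ) (p := 2) k).continuous.comp_aestronglyMeasurable
        (hgk k)
    · filter_upwards [hF] with ξ hξ
      have := (lp.hasSum_single (p := 2) (by norm_num) (F ξ)).tendsto_sum_nat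
      simpa only [hξ] using this
  have hn : eLpNorm F 2 (onIntegers μ) = ‖g‖ₑ := by
    have : eLpNorm F 2 (onIntegers μ) ^ 2 = ‖g‖ₑ ^ 2 := by
      rw [eLpNorm_two_sq, ← hint]
      refine lintegral_congr_ae ?_
      filter_upwards [hF] with ξ hξ
      simp only [enorm_sq_lp, hξ]
    exact (ENNReal.pow_right_strictMono two_ne_zero).injective this
  have hL : MemLp F 2 (onIntegers μ) := ⟨hm, by rw [hn]; exact enorm_lt_top⟩
  refine ⟨hL.toLp F, ?_, ?_⟩
  · filter_upwards [hL.coeFn_toLp, hF] with ξ h1 h2 k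
    rw [h1, h2]
  · rw [Lp.norm_toLp, hn, toReal_enorm]

theorem fiberization_spec (f : L2 μ) : IsFiberization D μ f (fiberization D μ f) := by
  have h : ∃ F, IsFiberization D μ f F := by
    obtain ⟨F, hF, -⟩ := D.exists_fiber (fourier D μ f)
    exact ⟨F, hF⟩
  rw [fiberization, dif_pos h]
  exact h.choose_spec

theorem ae_translate {P : K → Prop} (h : ∀ᵐ x ∂μ, P x) :
    ∀ᵐ ξ ∂(onIntegers μ), ∀ k, P (ξ + D.u k) := by
  refine ae_all_iff.2 fun k => ?_
  exact (measurePreserving_integers (D.u k)).quasiMeasurePreserving.ae (ae_restrict_of_ae h)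

/-- The fiberization map as a linear isometry. -/
def fiberizationₗᵢ (hμ : μ (Metric.closedBall (0 : K) 1) = 1) : L2 μ →ₗᵢ[ℂ] L2Fiber μ where
  toFun := fiberization D μ
  map_add' f g := by
    refine (D.fiberization_spec (f + g)).unique ?_
    filter_upwards [D.fiberization_spec f, D.fiberization_spec g,
      Lp.coeFn_add (fiberization D μ f) (fiberization D μ g),
      D.ae_translate (Lp.coeFn_add (fourier D μ f) (fourier D μ g))] with ξ h1 h2 h3 h4 k
    rw [h3, map_add, h4 k, Pi.add_apply, Pi.add_apply, lp.coeFn_add, Pi.add_apply, h1, h2]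
  map_smul' a f := by
    refine (D.fiberization_spec (a • f)).unique ?_
    filter_upwards [D.fiberization_spec f, Lp.coeFn_smul a (fiberization D μ f),
      D.ae_translate (Lp.coeFn_smul a (fourier D μ f))] with ξ h1 h2 h3 k
    rw [RingHom.id_apply, h2, map_smul, h3 k, Pi.smul_apply, Pi.smul_apply, lp.coeFn_smul,
      Pi.smul_apply, h1]
  norm_map' f := by
    obtain ⟨F, hF, hn⟩ := D.exists_fiber (fourier D μ f)
    have : fiberization D μ f = F := (D.fiberization_spec f).unique hF
    change ‖fiberization D μ f‖ = ‖f‖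
    rw [this, hn, D.fourier_eq hμ]
    exact (D.unitary hμ).norm_map f

theorem fiberizationₗᵢ_apply (hμ : μ (Metric.closedBall (0 : K) 1) = 1) (f : L2 μ) :
    D.fiberizationₗᵢ hμ f = fiberization D μ f := rfl

/-- The fiberization map turns translations into modulations. -/
theorem fiberization_translate (hμ : μ (Metric.closedBall (0 : K) 1) = 1) (k : ℕ) (f : L2 μ) :
    fiberization D μ (translate μ D k f) =ᵐ[onIntegers μ]
      fun ξ => (D.χ (-(D.u k * ξ)) : ℂ) • fiberization D μ f ξ := by
  filter_upwards [D.fiberization_spec f, D.fiberization_spec (translate μ D k f),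
    D.ae_translate (D.fourier_translate hμ k f)] with ξ h1 h2 h3
  ext l
  rw [h2, h3, lp.coeFn_smul, Pi.smul_apply, h1, smul_eq_mul]
  have : -(D.u k * (ξ + D.u l)) = -(D.u k * ξ) + -(D.u k * D.u l) := by ring
  rw [this, coe_χ_add, AddChar.map_neg_eq_inv _ (D.u k * D.u l), χ_mul_u]
  simp

theorem inner_modulation {k : ℕ} {F G H : L2Fiber μ}
    (hH : H =ᵐ[onIntegers μ] fun ξ => (D.χ (-(D.u k * ξ)) : ℂ) • F ξ) :
    ⟪H, G⟫_ℂ = ∫ ξ, (D.χ (D.u k * ξ) : ℂ) * ⟪F ξ, G ξ⟫_ℂ ∂(onIntegers μ) := by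
  rw [L2.inner_def]
  refine integral_congr_ae ?_
  filter_upwards [hH] with ξ hξ
  rw [hξ, inner_smul_left, conj_coe_χ, neg_neg]

/-- If `G` is orthogonal to all modulations of `F`, then it is pointwise orthogonal to `F`. -/
theorem ae_inner_eq_zero {F G : L2Fiber μ}
    (h : ∀ k, ∃ H : L2Fiber μ, H =ᵐ[onIntegers μ] (fun ξ => (D.χ (-(D.u k * ξ)) : ℂ) • F ξ) ∧
      ⟪H, G⟫_ℂ = 0) : ∀ᵐ ξ ∂(onIntegers μ), ⟪F ξ, G ξ⟫_ℂ = 0 := by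
  refine D.ae_eq_zero_of_coeff μ 0 (L2.integrable_inner F G) fun k => ?_
  obtain ⟨H, hH, h0⟩ := h k
  rw [← h0, D.inner_modulation hH]

/-- A closed subspace that contains all modulations of a set of functions whose values are dense
in `J` a.e., and that consists of functions with values in `J`, contains all of these. -/
theorem fiberSubmodule_le {W : Submodule ℂ (L2Fiber μ)} (hW : IsClosed (W : Set (L2Fiber μ)))
    {J : K → ClosedSubmodule ℂ Seq} (hWJ : W ≤ fiberSubmodule μ J) {A : Set (L2Fiber μ)}
    (hA : A.Countable)
    (hJ : ∀ᵐ ξ ∂(onIntegers μ),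
      (J ξ : Set Seq) ⊆ (Submodule.span ℂ ((fun F : L2Fiber μ => F ξ) '' A)).topologicalClosure)
    (hmod : ∀ F ∈ A, ∀ k, ∃ H ∈ W,
      H =ᵐ[onIntegers μ] fun ξ => (D.χ (-(D.u k * ξ)) : ℂ) • F ξ) :
    fiberSubmodule μ J ≤ W := by
  have : CompleteSpace W := hW.completeSpace_coe
  intro F hF
  -- G is the component of F orthogonal to W. It still takes values in J, so it must be shown to be
  -- pointwise orthogonal to J.
  set G := F - W.starProjection F with hG
  have hGW : G ∈ Wᗮ := W.sub_starProjection_mem_orthogonal F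
  have hGJ : G ∈ fiberSubmodule μ J := sub_mem hF (hWJ (W.starProjection_apply_mem F))
  have h1 : ∀ᵐ ξ ∂(onIntegers μ), ∀ H ∈ A, ⟪H ξ, G ξ⟫_ℂ = 0 := by
    refine (ae_ball_iff hA).2 fun H hH => D.ae_inner_eq_zero fun k => ?_
    obtain ⟨H', hH', e⟩ := hmod H hH k
    exact ⟨H', e, (Submodule.mem_orthogonal _ _).1 hGW _ hH'⟩
  have h0 : G = 0 := by
    refine Lp.eq_zero_iff_ae_eq_zero.2 ?_
    filter_upwards [h1, hJ, hGJ] with ξ h2 h3 h4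
    have hle : (Submodule.span ℂ ((fun F : L2Fiber μ => F ξ) '' A)).topologicalClosure ≤
        (Submodule.span ℂ {G ξ})ᗮ := by
      refine Submodule.topologicalClosure_minimal _ ?_ (Submodule.isClosed_orthogonal _)
      rw [Submodule.span_le]
      rintro _ ⟨H, hH, rfl⟩
      refine Submodule.mem_orthogonal_singleton_iff_inner_left.2 (h2 H hH)
    have := Submodule.mem_orthogonal_singleton_iff_inner_left.1 (hle (h3 h4))
    exact inner_self_eq_zero.1 this
  rw [sub_eq_zero.1 h0]
  exact W.starProjection_apply_mem F

/-- The image of a closed subspace under the fiberization map is closed. -/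
theorem isClosed_map_fiberization (hμ : μ (Metric.closedBall (0 : K) 1) = 1)
    {V : Submodule ℂ (L2 μ)} (hV : IsClosed (V : Set (L2 μ))) :
    IsClosed ((V.map (D.fiberizationₗᵢ hμ).toLinearMap : Submodule ℂ (L2Fiber μ)) :
      Set (L2Fiber μ)) := by
  rw [Submodule.map_coe]
  exact (D.fiberizationₗᵢ hμ).isometry.isClosedEmbedding.isClosedMap _ hV

theorem image_fiberization (hμ : μ (Metric.closedBall (0 : K) 1) = 1) {V : Submodule ℂ (L2 μ)}
    (hV : IsTranslationInvariant μ D V) {J : K → ClosedSubmodule ℂ Seq}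
    (hJ : IsRangeFunction D μ V J) :
    V.map (D.fiberizationₗᵢ hμ).toLinearMap = fiberSubmodule μ J := by
  have hle : V.map (D.fiberizationₗᵢ hμ).toLinearMap ≤ fiberSubmodule μ J := by
    rintro _ ⟨f, hf, rfl⟩
    exact hJ.mem f hf
  refine le_antisymm hle ?_
  obtain ⟨A, hA, hAV, hd⟩ := hJ.dense
  refine D.fiberSubmodule_le (D.isClosed_map_fiberization hμ hV.isClosed) hle
    (hA.image (fiberization D μ)) ?_ ?_
  · filter_upwards [hd] with ξ hξ
    refine hξ.trans (closure_mono ?_)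
    rw [Set.image_image]
    exact Submodule.subset_span
  · rintro _ ⟨f, hf, rfl⟩ k
    exact ⟨_, ⟨_, hV.translate_mem f (hAV hf) k, rfl⟩, D.fiberization_translate hμ k f⟩

/-- J(ξ) is the closed span of the fibers of a dense sequence in V. Since values, not their spans,
must be dense, the countable set consists of all finite combinations with coefficients from a dense
sequence in ℂ. -/
theorem exists_isRangeFunction (hμ : μ (Metric.closedBall (0 : K) 1) = 1)
    (V : Submodule ℂ (L2 μ)) : ∃ J, IsRangeFunction D μ V J := by
  -- This provides separability of L²(K), needed for a dense sequence in V.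
  have : Fact ((2 : ℝ≥0∞) ≠ ∞) := ⟨by norm_num⟩
  let c : ℕ → ℂ := TopologicalSpace.denseSeq ℂ
  let f : ℕ → V := TopologicalSpace.denseSeq V
  let T := D.fiberizationₗᵢ hμ
  let J : K → ClosedSubmodule ℂ Seq := fun ξ =>
    (Submodule.span ℂ (Set.range fun j => T (f j) ξ)).closure
  let comb : List (ℕ × ℕ) → L2 μ := fun l => (l.map fun i => c i.1 • (f i.2 : L2 μ)).sum
  -- There are countably many lists, so one null set serves for linearity on all combinations.
  have hcomb : ∀ᵐ ξ ∂(onIntegers μ), ∀ l : List (ℕ × ℕ),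
      T (comb l) ξ = (l.map fun i => c i.1 • T (f i.2) ξ).sum := by
    have h0 : ∀ᵐ ξ ∂(onIntegers μ), T 0 ξ = 0 := by
      rw [map_zero]
      exact Lp.coeFn_zero _ _ _
    have h1 : ∀ᵐ ξ ∂(onIntegers μ), ∀ (i : ℕ × ℕ) (l : List (ℕ × ℕ)),
        T (c i.1 • (f i.2 : L2 μ) + comb l) ξ = c i.1 • T (f i.2) ξ + T (comb l) ξ := by
      refine ae_all_iff.2 fun i => ae_all_iff.2 fun l => ?_
      rw [map_add, map_smul]
      filter_upwards [Lp.coeFn_add (c i.1 • T (f i.2)) (T (comb l)),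
        Lp.coeFn_smul (c i.1) (T (f i.2))] with ξ h2 h3
      rw [h2, Pi.add_apply, h3, Pi.smul_apply]
    filter_upwards [h0, h1] with ξ h2 h3 l
    induction l with
    | nil => exact h2
    | cons i l ih => rw [List.map_cons, List.sum_cons, ← ih, ← h3]; rfl
  refine ⟨J, fun g hg => ?_, Set.range comb, Set.countable_range _, ?_, ?_⟩
  · have hcl : IsClosed ((fun g : V => T g) ⁻¹' (fiberSubmodule μ J : Set (L2Fiber μ))) :=
      (isClosed_fiberSubmodule J).preimage (T.continuous.comp continuous_subtype_val)
    have hsub : Set.range f ⊆ (fun g : V => T g) ⁻¹' (fiberSubmodule μ J : Set (L2Fiber μ)) := by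
      rintro _ ⟨j, rfl⟩
      refine mem_fiberSubmodule.2 (.of_forall fun ξ => ?_)
      exact Submodule.le_topologicalClosure _ (Submodule.subset_span ⟨j, rfl⟩)
    have hd : Dense (Set.range f) := TopologicalSpace.denseRange_denseSeq V
    have h1 := closure_minimal hsub hcl
    rw [hd.closure_eq] at h1
    have h2 := h1 (Set.mem_univ (⟨g, hg⟩ : V))
    rw [Set.mem_preimage, SetLike.mem_coe, mem_fiberSubmodule] at h2
    exact h2
  · rintro _ ⟨l, rfl⟩
    refine V.list_sum_mem ?_
    intro x hx
    obtain ⟨i, -, rfl⟩ := List.mem_map.1 hx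
    exact V.smul_mem _ (f i.2).2
  · filter_upwards [hcomb] with ξ hξ
    refine closure_minimal ?_ isClosed_closure
    set S := (fun f => fiberization D μ f ξ) '' Set.range comb with hS
    have hmem : ∀ l : List (ℕ × ℕ), (l.map fun i => c i.1 • T (f i.2) ξ).sum ∈ S :=
      fun l => ⟨comb l, ⟨l, rfl⟩, hξ l⟩
    intro x hx
    induction hx using Submodule.closure_induction with
    | zero => exact subset_closure (hmem [])
    | add x y _ _ hx hy =>
      refine map_mem_closure₂ continuous_add hx hy ?_
      rintro _ ⟨_, ⟨l, rfl⟩, rfl⟩ _ ⟨_, ⟨l', rfl⟩, rfl⟩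
      have := hmem (l ++ l')
      rw [List.map_append, List.sum_append, ← hξ, ← hξ] at this
      exact this
    | smul_mem r x hx =>
      obtain ⟨j, rfl⟩ := hx
      refine map_mem_closure (f := fun a : ℂ => a • T (f j) ξ) (by fun_prop)
        (TopologicalSpace.denseRange_denseSeq ℂ r) ?_
      rintro _ ⟨i, rfl⟩
      have := hmem [(i, j)]
      simpa using this

end Data

end

end LFPC

/-! ### Parseval generators and the multiplicity function -/

namespace LFPC

section


/-- The dimension of the closed span of an orthogonal family of vectors of norm zero or one. -/
theorem toENat_rank_closure_span {ι : Type} {v : ι → Seq}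
    (hv : ∀ n, ‖v n‖ₑ ^ 2 = 0 ∨ ‖v n‖ₑ ^ 2 = 1) (ho : Pairwise fun m n => ⟪v m, v n⟫_ℂ = 0)
    {J : ClosedSubmodule ℂ Seq} (hJ : J = (Submodule.span ℂ (Set.range v)).closure) :
    ((Cardinal.toENat (Module.rank ℂ J.toSubmodule) : ℕ∞) : ℝ≥0∞) = ∑' n, ‖v n‖ₑ ^ 2 := by
  set s : Set ι := {n | v n ≠ 0} with hs
  have hone : ∀ n : s, ‖v n‖ₑ ^ 2 = 1 := fun n => (hv n).resolve_left fun h => n.2 (by simpa using h)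
  have hsum : ∑' n, ‖v n‖ₑ ^ 2 = s.encard := by
    rw [← ENNReal.tsum_set_one, ← tsum_subtype_eq_of_support_subset (s := s)]
    · exact tsum_congr hone
    · intro n hn h0
      exact hn (by simp [h0])
  have hon : Orthonormal ℂ fun n : s => v n := by
    refine ⟨fun n => ?_, fun m n hmn => ho fun h => hmn (Subtype.ext h)⟩
    have h1 := hone n
    rw [← ofReal_norm, ← ENNReal.ofReal_pow (norm_nonneg _), ENNReal.ofReal_eq_one] at h1
    exact (pow_eq_one_iff_of_nonneg (norm_nonneg _) two_ne_zero).1 h1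
  have hli := hon.linearIndependent
  rw [hsum]
  congr 1
  have hspan : Submodule.span ℂ (Set.range v) = Submodule.span ℂ (Set.range fun n : s => v n) := by
    refine le_antisymm (Submodule.span_le.2 ?_) (Submodule.span_mono ?_)
    · rintro _ ⟨n, rfl⟩
      by_cases h : v n = 0
      · rw [h]; exact zero_mem _
      · exact Submodule.subset_span ⟨⟨n, h⟩, rfl⟩
    · rintro _ ⟨n, rfl⟩
      exact ⟨n, rfl⟩
  by_cases hfin : Finite s
  · have : FiniteDimensional ℂ (Submodule.span ℂ (Set.range fun n : s => v n)) :=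
      FiniteDimensional.span_of_finite ℂ (Set.finite_range _)
    have hJ' : J.toSubmodule = Submodule.span ℂ (Set.range fun n : s => v n) := by
      rw [hJ, hspan]
      exact IsClosed.submodule_topologicalClosure_eq (Submodule.closed_of_finiteDimensional _)
    rw [hJ', rank_span hli, Cardinal.mk_range_eq _ hli.injective]
    rfl
  -- All infinite cardinals become ∞, so an infinite independent family in J suffices; the algebraic
  -- dimension of the closure need not be known.
  · have hinf : Infinite s := not_finite_iff_infinite.1 hfin
    have hmem : ∀ n : s, v n ∈ J.toSubmodule := fun n => by
      rw [hJ]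
      exact Submodule.le_topologicalClosure _ (Submodule.subset_span ⟨n, rfl⟩)
    have hli' : LinearIndependent ℂ fun n : s => (⟨v n, hmem n⟩ : J.toSubmodule) :=
      LinearIndependent.of_comp J.toSubmodule.subtype hli
    rw [Cardinal.toENat_eq_top.2 ((Cardinal.infinite_iff.1 hinf).trans hli'.cardinal_le_rank),
      Set.encard_eq_top_iff.2 (Set.infinite_coe_iff.1 hinf)]

variable {K : Type*} [NontriviallyNormedField K] {p : ℕ} [Fact p.Prime] [IsUltrametricDist K]
variable [MeasurableSpace K] [BorelSpace K] {μ : Measure K} [μ.IsAddHaarMeasure] [ProperSpace K]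

namespace Data

variable (D : Data K p)

/-- Parseval's identity for Fourier series on `𝒪`. -/
theorem tsum_coeff_sq (hμ : μ (Metric.closedBall (0 : K) 1) = 1) {g : K → ℂ}
    (hg : MemLp g 2 (onIntegers μ)) :
    ∑' l, ‖∫ ξ, (D.χ (D.u l * ξ) : ℂ) * g ξ ∂(onIntegers μ)‖ₑ ^ 2 =
      ∫⁻ ξ, ‖g ξ‖ₑ ^ 2 ∂(onIntegers μ) := by
  have hG := (memLp_indicator_iff_restrict (measurableSet_closedBall (x := (0 : K)) (ε := 1))).2 hg
  set G : L2 μ := hG.toLp _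
  have hGc : G =ᵐ[μ] (Metric.closedBall (0 : K) 1).indicator g := hG.coeFn_toLp
  have h1 : ‖G‖ₑ ^ 2 = ∫⁻ ξ, ‖g ξ‖ₑ ^ 2 ∂(onIntegers μ) := by
    rw [Lp.enorm_def, eLpNorm_congr_ae hGc,
      eLpNorm_indicator_eq_eLpNorm_restrict measurableSet_closedBall, eLpNorm_two_sq]
  have h2 : ‖G‖ₑ ^ 2 = ∑' i : ℕ × ℕ, ‖⟪D.conj.atom μ i.1 i.2, G⟫_ℂ‖ₑ ^ 2 := by
    have e : ‖(D.conj.atomBasis hμ).repr G‖ₑ = ‖G‖ₑ := by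
      rw [← ofReal_norm, LinearIsometryEquiv.norm_map, ofReal_norm]
    rw [← e, enorm_sq_lp]
    refine tsum_congr fun i => ?_
    rw [HilbertBasis.repr_apply_apply, atomBasis_apply]
  -- G is supported on 𝒪, the coset of u(0) = 0, so only the atoms at position 0 see it.
  have hzero : ∀ k, k ≠ 0 → ∑' l, ‖⟪D.conj.atom μ k l, G⟫_ℂ‖ₑ ^ 2 = 0 := by
    intro k hk
    refine ENNReal.tsum_eq_zero.2 fun l => ?_
    have : ⟪D.conj.atom μ k l, G⟫_ℂ = 0 := by
      rw [inner_atom]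
      refine integral_eq_zero_of_ae ?_
      filter_upwards [ae_restrict_of_ae hGc, ae_restrict_mem measurableSet_closedBall]
        with ξ h3 h4
      have h5 : ξ ∉ Metric.closedBall (0 : K) 1 := by
        have := Set.disjoint_left.1 (D.pairwise_disjoint_coset hk) h4
        simpa only [u_zero] using this
      rw [h3, Set.indicator_of_notMem h5, mul_zero, Pi.zero_apply]
    rw [this]
    simp
  rw [← h1, h2, ENNReal.tsum_prod (f := fun k l => ‖⟪D.conj.atom μ k l, G⟫_ℂ‖ₑ ^ 2),
    tsum_eq_single 0 hzero]
  refine tsum_congr fun l => ?_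
  rw [inner_atom, conj_u, conj_u, u_zero]
  congr 2
  refine integral_congr_ae ?_
  filter_upwards [ae_restrict_of_ae hGc, ae_restrict_mem measurableSet_closedBall] with ξ h3 h4
  rw [h3, Set.indicator_of_mem h4, conj_χ, neg_neg]

theorem translate_mem_principal (k : ℕ) (φ : L2 μ) : translate μ D k φ ∈ principal μ D φ :=
  Submodule.le_topologicalClosure _ (Submodule.subset_span ⟨k, rfl⟩)

theorem mem_principal (φ : L2 μ) : φ ∈ principal μ D φ := by
  have h : translate μ D 0 φ = φ := by
    refine Lp.ext ((D.coeFn_translate 0 φ).trans (.of_forall fun x => ?_))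
    simp only [D.u_zero, sub_zero]
  have h0 := D.translate_mem_principal 0 φ
  rwa [h] at h0

/-- The fibers of a principal space lie in any range function that contains the fibers of the
generator. -/
theorem fiberization_mem_of_mem_principal (hμ : μ (Metric.closedBall (0 : K) 1) = 1)
    {J : K → ClosedSubmodule ℂ Seq} {φ : L2 μ}
    (h : fiberization D μ φ ∈ fiberSubmodule μ J) :
    principal μ D φ ≤ (fiberSubmodule μ J).comap (D.fiberizationₗᵢ hμ).toLinearMap := by
  refine Submodule.topologicalClosure_minimal _ (Submodule.span_le.2 ?_)
    ((isClosed_fiberSubmodule J).preimage (D.fiberizationₗᵢ hμ).continuous)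
  rintro _ ⟨k, rfl⟩
  change fiberization D μ (translate μ D k φ) ∈ fiberSubmodule μ J
  rw [mem_fiberSubmodule] at h ⊢
  filter_upwards [h, D.fiberization_translate hμ k φ] with ξ h1 h2
  rw [h2]
  exact SMulMemClass.smul_mem _ h1

/-- Every function whose values are multiples of those of the fiberization of `φ` is the
fiberization of an element of the principal space generated by `φ`. -/
theorem exists_mem_principal (hμ : μ (Metric.closedBall (0 : K) 1) = 1) {φ : L2 μ} {H : L2Fiber μ}
    (hH : ∀ᵐ ξ ∂(onIntegers μ), H ξ ∈ Submodule.span ℂ {fiberization D μ φ ξ}) :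
    ∃ f ∈ principal μ D φ, fiberization D μ f = H := by
  let J : K → ClosedSubmodule ℂ Seq := fun ξ =>
    (Submodule.span ℂ {fiberization D μ φ ξ}).closure
  have hφ : fiberization D μ φ ∈ fiberSubmodule μ J := mem_fiberSubmodule.2 <|
    .of_forall fun ξ => Submodule.le_topologicalClosure _ (Submodule.mem_span_singleton_self _)
  have hle : fiberSubmodule μ J ≤ (principal μ D φ).map (D.fiberizationₗᵢ hμ).toLinearMap := by
    refine D.fiberSubmodule_le (D.isClosed_map_fiberization hμ
      (Submodule.isClosed_topologicalClosure _))
      (Submodule.map_le_iff_le_comap.2 (D.fiberization_mem_of_mem_principal hμ hφ))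
      (Set.countable_singleton (fiberization D μ φ)) (.of_forall fun ξ => ?_) ?_
    · rw [Set.image_singleton]
      exact subset_rfl
    · rintro _ rfl k
      exact ⟨_, ⟨_, D.translate_mem_principal k φ, rfl⟩, D.fiberization_translate hμ k φ⟩
  have hHJ : H ∈ fiberSubmodule μ J := by
    rw [mem_fiberSubmodule]
    filter_upwards [hH] with ξ hξ
    exact Submodule.le_topologicalClosure _ hξ
  obtain ⟨f, hf, e⟩ := hle hHJ
  exact ⟨f, hf, e⟩

/-- The Parseval frame identity is tested on the f ∈ V_φ with 𝒯f = 1_E 𝒯φ. Its frame coefficients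
have the absolute values of the Fourier coefficients of 1_E ‖𝒯φ‖², so their squares sum to the left
side, while ‖f‖² is the right side. The bound N keeps 1_E ‖𝒯φ‖² in L². -/
theorem setLIntegral_sq_eq (hμ : μ (Metric.closedBall (0 : K) 1) = 1) {φ : L2 μ}
    (hφ : IsParsevalGenerator μ D φ) {E : Set K} (hE : MeasurableSet E) {N : ℝ}
    (hN : ∀ ξ ∈ E, ‖fiberization D μ φ ξ‖ ≤ N) :
    ∫⁻ ξ in E, (‖fiberization D μ φ ξ‖ₑ ^ 2) ^ 2 ∂(onIntegers μ) =
      ∫⁻ ξ in E, ‖fiberization D μ φ ξ‖ₑ ^ 2 ∂(onIntegers μ) := by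
  set F := fiberization D μ φ with hF
  have hL := (Lp.memLp F).indicator hE
  set H : L2Fiber μ := hL.toLp _
  have hH : H =ᵐ[onIntegers μ] E.indicator F := hL.coeFn_toLp
  obtain ⟨f, hf, hfH⟩ := D.exists_mem_principal hμ (φ := φ) (H := H) (by
    filter_upwards [hH] with ξ hξ
    rw [hξ]
    by_cases h : ξ ∈ E
    · rw [Set.indicator_of_mem h]
      exact Submodule.mem_span_singleton_self _
    · rw [Set.indicator_of_notMem h]
      exact zero_mem _)
  let g : K → ℂ := E.indicator fun ξ => ((‖F ξ‖ ^ 2 : ℝ) : ℂ)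
  have hFm : StronglyMeasurable F := Lp.stronglyMeasurable F
  have hgm : MemLp g 2 (onIntegers μ) := by
    refine MemLp.of_bound (StronglyMeasurable.aestronglyMeasurable ?_) (N ^ 2)
      (.of_forall fun ξ => ?_)
    · exact (Complex.continuous_ofReal.comp_stronglyMeasurable (hFm.norm.pow 2)).indicator hE
    · by_cases h : ξ ∈ E
      · simp only [g]
        rw [Set.indicator_of_mem h, Complex.norm_real, Real.norm_of_nonneg (by positivity)]
        exact pow_le_pow_left₀ (norm_nonneg _) (hN ξ h) 2
      · simp only [g]
        rw [Set.indicator_of_notMem h, norm_zero]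
        positivity
  have hcoef : ∀ k, ‖⟪f, translate μ D k φ⟫_ℂ‖ =
      ‖∫ ξ, (D.χ (D.u k * ξ) : ℂ) * g ξ ∂(onIntegers μ)‖ := by
    intro k
    rw [norm_inner_symm, ← (D.fiberizationₗᵢ hμ).inner_map_map, fiberizationₗᵢ_apply,
      fiberizationₗᵢ_apply, hfH, D.inner_modulation (D.fiberization_translate hμ k φ)]
    congr 1
    refine integral_congr_ae ?_
    filter_upwards [hH] with ξ hξ
    rw [hξ]
    by_cases h : ξ ∈ E
    · simp only [g]
      rw [Set.indicator_of_mem h, Set.indicator_of_mem h, inner_self_eq_norm_sq_to_K,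
        Complex.ofReal_pow]
      rfl
    · simp only [g]
      rw [Set.indicator_of_notMem h, Set.indicator_of_notMem h, inner_zero_right]
  have hsum := hφ f hf
  have h1 : ‖f‖ₑ ^ 2 = ∫⁻ ξ, ‖g ξ‖ₑ ^ 2 ∂(onIntegers μ) := by
    rw [← D.tsum_coeff_sq hμ hgm, ← ofReal_norm, ← ENNReal.ofReal_pow (norm_nonneg _),
      ← hsum.tsum_eq, ENNReal.ofReal_tsum_of_nonneg (fun _ => by positivity) hsum.summable]
    refine tsum_congr fun k => ?_
    rw [hcoef, ← ofReal_norm, ENNReal.ofReal_pow (norm_nonneg _)]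
  have h2 : ‖f‖ₑ ^ 2 = ∫⁻ ξ in E, ‖F ξ‖ₑ ^ 2 ∂(onIntegers μ) := by
    have : ‖f‖ₑ = ‖H‖ₑ := by
      rw [← hfH, ← D.fiberizationₗᵢ_apply hμ, ← ofReal_norm, ← ofReal_norm,
        LinearIsometry.norm_map]
    rw [this, Lp.enorm_def, eLpNorm_congr_ae hH, eLpNorm_indicator_eq_eLpNorm_restrict hE,
      eLpNorm_two_sq]
  rw [← h2, h1, ← lintegral_indicator hE]
  refine lintegral_congr fun ξ => ?_
  by_cases h : ξ ∈ E
  · simp only [g]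
    rw [Set.indicator_of_mem h, Set.indicator_of_mem h, ← ofReal_norm (((‖F ξ‖ ^ 2 : ℝ) : ℂ)),
      Complex.norm_real, Real.norm_of_nonneg (by positivity), ENNReal.ofReal_pow (norm_nonneg _),
      ofReal_norm]
  · simp only [g]
    rw [Set.indicator_of_notMem h, Set.indicator_of_notMem h]
    simp

/-- The fibers of a Parseval frame generator have norm zero or one. -/
theorem enorm_sq_fiberization (hμ : μ (Metric.closedBall (0 : K) 1) = 1) {φ : L2 μ}
    (hφ : IsParsevalGenerator μ D φ) : ∀ᵐ ξ ∂(onIntegers μ),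
      ‖fiberization D μ φ ξ‖ₑ ^ 2 = 0 ∨ ‖fiberization D μ φ ξ‖ₑ ^ 2 = 1 := by
  set F := fiberization D μ φ with hF
  have hFm : StronglyMeasurable F := Lp.stronglyMeasurable F
  -- Truncation supplies the bound required for the integral identity; these sets exhaust 𝒪. With t
  -- = ‖F(ξ)‖² finite, t² = t leaves only 0 and 1.
  have hS : ∀ N : ℕ, MeasurableSet {ξ | ‖F ξ‖ ≤ N} := fun N =>
    hFm.norm.measurable measurableSet_Iic
  have h1 : ∀ N : ℕ, ∀ᵐ ξ ∂(onIntegers μ), ξ ∈ {ξ | ‖F ξ‖ ≤ N} →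
      (‖F ξ‖ₑ ^ 2) ^ 2 = ‖F ξ‖ₑ ^ 2 := by
    intro N
    rw [← ae_restrict_iff' (hS N)]
    refine ae_eq_of_forall_setLIntegral_eq_of_sigmaFinite
      ((hFm.enorm.pow_const 2).pow_const 2) (hFm.enorm.pow_const 2) fun s hs _ => ?_
    rw [Measure.restrict_restrict hs]
    exact D.setLIntegral_sq_eq hμ hφ (hs.inter (hS N)) fun ξ hξ => hξ.2
  filter_upwards [ae_all_iff.2 h1] with ξ hξ
  obtain ⟨N, hN⟩ := exists_nat_ge ‖F ξ‖
  have h2 := hξ N hN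
  by_cases h0 : ‖F ξ‖ₑ ^ 2 = 0
  · exact .inl h0
  · right
    have htop : ‖F ξ‖ₑ ^ 2 ≠ ∞ := ENNReal.pow_ne_top enorm_ne_top
    rw [sq (‖F ξ‖ₑ ^ 2)] at h2
    exact (ENNReal.mul_eq_left h0 htop).1 h2

theorem multiplicity_eq (hμ : μ (Metric.closedBall (0 : K) 1) = 1) {V : Submodule ℂ (L2 μ)}
    {J : K → ClosedSubmodule ℂ Seq} (hJ : IsRangeFunction D μ V J) {ι : Type} [Countable ι]
    {φ : ι → L2 μ} (hφ : IsParsevalDecomposition μ D V φ) :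
    ∀ᵐ ξ ∂(onIntegers μ), (multiplicity J ξ : ℝ≥0∞) =
      ∑' n : ι, ∑' k : ℕ, ‖fourier D μ (φ n) (ξ + D.u k)‖ₑ ^ 2 := by
  -- The closed span of the generators' fibers agrees a.e. with J, because the functions with fibers
  -- in J' form a closed space containing every V_{φ_n}.
  let J' : K → ClosedSubmodule ℂ Seq := fun ξ =>
    (Submodule.span ℂ (Set.range fun n => fiberization D μ (φ n) ξ)).closure
  have hφV : ∀ n, φ n ∈ V := by
    intro n
    rw [← hφ.sum_eq]
    exact Submodule.le_topologicalClosure _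
      (Submodule.mem_iSup_of_mem n (D.mem_principal (φ n)))
  have hVJ' : V ≤ (fiberSubmodule μ J').comap (D.fiberizationₗᵢ hμ).toLinearMap := by
    rw [← hφ.sum_eq]
    refine Submodule.topologicalClosure_minimal _ (iSup_le fun n => ?_)
      ((isClosed_fiberSubmodule J').preimage (D.fiberizationₗᵢ hμ).continuous)
    refine D.fiberization_mem_of_mem_principal hμ (mem_fiberSubmodule.2 (.of_forall fun ξ => ?_))
    exact Submodule.le_topologicalClosure _ (Submodule.subset_span ⟨n, rfl⟩)
  have hJJ' : ∀ᵐ ξ ∂(onIntegers μ), J ξ = J' ξ := by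
    obtain ⟨A, hA, hAV, hd⟩ := hJ.dense
    have h1 : ∀ᵐ ξ ∂(onIntegers μ), ∀ f ∈ A, fiberization D μ f ξ ∈ J' ξ :=
      (ae_ball_iff hA).2 fun f hf => hVJ' (hAV hf)
    have h2 : ∀ᵐ ξ ∂(onIntegers μ), ∀ n, fiberization D μ (φ n) ξ ∈ J ξ :=
      ae_all_iff.2 fun n => hJ.mem _ (hφV n)
    filter_upwards [hd, h1, h2] with ξ h3 h4 h5
    refine le_antisymm (fun x hx => ?_) (Submodule.closure_le.2 (Submodule.span_le.2 ?_))
    · refine closure_minimal ?_ (J' ξ).isClosed (h3 hx)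
      rintro _ ⟨f, hf, rfl⟩
      exact h4 f hf
    · rintro _ ⟨n, rfl⟩
      exact h5 n
  have hnorm : ∀ᵐ ξ ∂(onIntegers μ), ∀ n,
      ‖fiberization D μ (φ n) ξ‖ₑ ^ 2 = 0 ∨ ‖fiberization D μ (φ n) ξ‖ₑ ^ 2 = 1 :=
    ae_all_iff.2 fun n => D.enorm_sq_fiberization hμ (hφ.parseval n)
  have hortho : ∀ᵐ ξ ∂(onIntegers μ), ∀ m n, m ≠ n →
      ⟪fiberization D μ (φ m) ξ, fiberization D μ (φ n) ξ⟫_ℂ = 0 := by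
    refine ae_all_iff.2 fun m => ae_all_iff.2 fun n => ?_
    by_cases hmn : m = n
    · exact .of_forall fun _ h => absurd hmn h
    refine (D.ae_inner_eq_zero (F := fiberization D μ (φ m)) (G := fiberization D μ (φ n))
      fun k => ⟨_, D.fiberization_translate hμ k (φ m), ?_⟩).mono fun ξ h _ => h
    rw [← D.fiberizationₗᵢ_apply hμ, ← D.fiberizationₗᵢ_apply hμ, LinearIsometry.inner_map_map]
    refine Submodule.isOrtho_iff_inner_eq.1 (hφ.orthogonal hmn) _
      (D.translate_mem_principal k _) _ (D.mem_principal (φ n))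
  have hspec : ∀ᵐ ξ ∂(onIntegers μ), ∀ n k,
      fiberization D μ (φ n) ξ k = fourier D μ (φ n) (ξ + D.u k) :=
    ae_all_iff.2 fun n => D.fiberization_spec (φ n)
  filter_upwards [hJJ', hnorm, hortho, hspec] with ξ h1 h2 h3 h4
  rw [multiplicity, toENat_rank_closure_span h2 (fun m n h => h3 m n h) h1]
  refine tsum_congr fun n => ?_
  rw [enorm_sq_lp]
  simp only [h4]

end Data

end

end LFPC

theorem proposition3p2p3 {K : Type*} [NontriviallyNormedField K] [IsUltrametricDist K]
    [LocallyCompactSpace K] [MeasurableSpace K] [BorelSpace K]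
    (p : ℕ) [Fact p.Prime] [CharP K p] (D : LFPC.Data K p)
    (μ : Measure K) [μ.IsAddHaarMeasure] (hμ : μ (Metric.closedBall (0 : K) 1) = 1)
    (V : Submodule ℂ (LFPC.L2 μ)) (hV : LFPC.IsTranslationInvariant μ D V) :
    -- the Fourier transform, the fiberization map and the range function are well defined
    LFPC.IsFourierExtension D μ (LFPC.fourier D μ) ∧
    (∀ f : LFPC.L2 μ, LFPC.IsFiberization D μ f (LFPC.fiberization D μ f)) ∧
    (∃ J : K → ClosedSubmodule ℂ LFPC.Seq, LFPC.IsRangeFunction D μ V J) ∧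
    ∀ J : K → ClosedSubmodule ℂ LFPC.Seq, LFPC.IsRangeFunction D μ V J →
      -- the image of `V`
      LFPC.fiberization D μ '' (V : Set (LFPC.L2 μ)) =
        {F : LFPC.L2Fiber μ | ∀ᵐ ξ ∂(LFPC.onIntegers μ), F ξ ∈ J ξ} ∧
      -- the multiplicity function
      ∀ (ι : Type) [Countable ι] (φ : ι → LFPC.L2 μ), LFPC.IsParsevalDecomposition μ D V φ →
        ∀ᵐ ξ ∂(LFPC.onIntegers μ), (LFPC.multiplicity J ξ : ℝ≥0∞) =
          ∑' n : ι, ∑' k : ℕ, ‖LFPC.fourier D μ (φ n) (ξ + D.u k)‖ₑ ^ 2 := by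
  have : ProperSpace K := ProperSpace.of_locallyCompactSpace K
  refine ⟨D.fourier_spec hμ, D.fiberization_spec, D.exists_isRangeFunction hμ V, fun J hJ =>
    ⟨?_, fun ι _ φ hφ => D.multiplicity_eq hμ hJ hφ⟩⟩
  exact congrArg (fun W : Submodule ℂ (LFPC.L2Fiber μ) => (W : Set (LFPC.L2Fiber μ)))
    (D.image_fiberization hμ hV hJ)

end
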